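/- Let $R=\mathbb{C}[x,y,z,w]$. A curve $C\subset\mathbb{P}^3$ is a one-dimensional closed subscheme (not necessarily reduced, irreducible or smooth), given by its saturated homogeneous ideal $I_C\subset R$, with $\dim R/I_C=2$. It is ACM if $R/I_C$ is a Cohen–Macaulay ring, and a complete intersection if $I_C$ is generated by two forms. A minimal generator of $I_C$ is a member of some minimal system of homogeneous generators of $I_C$. A weak admissible pair of length $t\ge 2$ and degree $d$ is a pair $(\hat a,\hat b)$ of sequences of integers $a_1\le\dots\le a_t$ and $b_1\le\dots\le b_t$ with $a_i<b_i$ for all $i$ and $\sum_{i=1}^t(b_i-a_i)=d$. Two pairs are equivalent if one arises from the other by adding the same integer to all $a_i$ and all $b_i$. A surface $X=V(F)\subset\mathbb{P}^3$ of degree $d$ is weak determinantal of type $(\hat a,\hat b)$, a weak admissible pair of degree $d$, if $F=\det(m_{ij})$ for some $t\times t$ matrix whose entry $m_{ij}$ is a form of degree $b_j-a_i$, with $m_{ij}=0$ if $a_i\ge b_j$. It is weak determinantal if it is so of some type. **Theorem.** Let $X=V(F)\subset\mathbb{P}^3$ be a surface of degree $d\ge1$, where $F\ne0$ is a form of degree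 $d$, and let $C\subseteq X$ be a curve. Let $\{(\hat a_i,\hat b_i)\}_{i\in I}$ be a family of types of $X$ such that every type of $X$ is equivalent to a member of the family. Then $C$ is ACM if and only if one of the following holds: 1. $X$ is not weak determinantal, and $C$ is a complete intersection. 2. $X$ is weak determinantal, and one of the following holds: - (i) $C$ is a complete intersection. - (ii) $C$ is not a complete intersection, $F$ is a minimal generator of $I_C$, and for some member $((a_1,\dots,a_t),(b_1,\dots,b_t))$ of the family and some $k\in\mathbb{Z}$, $I_C$ has a minimal graded free resolution $$0\to\bigoplus_{j=1}^{t}R(-(b_j+k))\to\bigoplus_{i=1}^{t}R(-(a_i+k))\oplus R(-d)\to I_C\to0.$$ - (iii) $C$ is not a complete intersection, $F$ is not a minimal generator of $I_C$, and for some member $((a_1,\dots,a_t),(b_1,\dots,b_t))$ of the family and some $j_0\in\{1,\dots,t\}$, $I_C$ has a minimal graded free resolution $$0\to\bigoplus_{i\ne j_0}R(-d+b_{j_0}-b_i)\to\bigoplus_{i=1}^{t}R(-d+b_{j_0}-a_i)\to I_C\to0.$$ The degrees in this resolution are those of the pair shifted by $k=d-b_{j_0}$, the shift whose second sequence has the entry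 $d$ at the place $j_0$. -/

import Mathlib

open MvPolynomial

namespace ACMCurve

/-- The homogeneous coordinate ring `ℂ[x, y, z, w]` of `ℙ³`. -/
abbrev Poly : Type := MvPolynomial (Fin 4) ℂ

/-- The irrelevant ideal `(x, y, z, w)`. -/
noncomputable def irrelevantIdeal : Ideal Poly := Ideal.span (Set.range X)

/-- `p` is homogeneous of the integer degree `n`; in negative degree only `0` is. -/
def IsForm (p : Poly) (n : ℤ) : Prop :=
  (n < 0 → p = 0) ∧ p.IsHomogeneous n.toNat

/-- A curve in `ℙ³`: a one-dimensional closed subscheme, not necessarily reduced, irreducible or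
smooth. It is given by its saturated homogeneous ideal `I_C`; closed subschemes of `ℙ³` correspond
bijectively to such ideals, and the homogeneous coordinate ring `ℂ[x, y, z, w] ⧸ I_C` of a
one-dimensional subscheme is the one that has Krull dimension two. -/
structure Curve where
  /-- the homogeneous ideal `I_C` of the curve -/
  ideal : Ideal Poly
  homogeneous : ∀ f ∈ ideal, ∀ n : ℕ, homogeneousComponent n f ∈ ideal
  saturated : ∀ f : Poly, (∀ i : Fin 4, X i * f ∈ ideal) → f ∈ ideal
  dim_eq : ringKrullDim (Poly ⧸ ideal) = 2

/-- The homogeneous coordinate ring of a curve. -/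
abbrev Curve.coordinateRing (C : Curve) : Type := Poly ⧸ C.ideal

/-- A Noetherian ring `A` is Cohen–Macaulay if `depth P = height P` for all maximal ideals `P`, that
is, if `P` contains a regular sequence of length `height P` (there are never longer ones). -/
def IsCohenMacaulay (A : Type*) [CommRing A] : Prop :=
  IsNoetherianRing A ∧
    ∀ P : Ideal A, P.IsMaximal →
      ∃ rs : List A, (∀ r ∈ rs, r ∈ P) ∧ RingTheory.Sequence.IsRegular A rs ∧
        (rs.length : ℕ∞) = P.height

/-- A curve is arithmetically Cohen–Macaulay if its homogeneous coordinate ring is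
Cohen–Macaulay. -/
def Curve.IsACM (C : Curve) : Prop := IsCohenMacaulay C.coordinateRing

/-- A curve is a complete intersection if two forms generate its ideal. -/
def Curve.IsCompleteIntersection (C : Curve) : Prop :=
  ∃ (f g : Poly) (m n : ℕ), f.IsHomogeneous m ∧ g.IsHomogeneous n ∧
    C.ideal = Ideal.span {f, g}

/-- `F` is a minimal generator of the homogeneous ideal `I`: it belongs to a system of homogeneous
generators of `I` of which no proper subset generates `I`. -/
def IsMinimalGenerator (F : Poly) (I : Ideal Poly) : Prop :=
  ∃ S : Finset Poly, F ∈ S ∧ (∀ g ∈ S, ∃ n : ℕ, g.IsHomogeneous n) ∧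
    Ideal.span (S : Set Poly) = I ∧
    ∀ T : Finset Poly, T ⊂ S → Ideal.span (T : Set Poly) ≠ I

/-- The ideal `I` has a minimal graded free resolution
`0 → ⨁ j, R(-β j) → ⨁ i, R(-α i) → I → 0`, where `R = ℂ[x, y, z, w]`. The left map is a matrix `M`
and the right map sends the `i`-th basis vector to `f i`. Both are homogeneous of degree zero, and
minimality means that the image of `M` lies in `(x, y, z, w) · ⨁ i, R(-α i)`. -/
def HasMinimalFreeResolution {ι κ : Type} [Fintype ι] [Fintype κ] (I : Ideal Poly)
    (α : ι → ℤ) (β : κ → ℤ) : Prop :=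
  ∃ (f : ι → Poly) (M : Matrix ι κ Poly),
    (∀ i, IsForm (f i) (α i)) ∧
    (∀ i j, IsForm (M i j) (β j - α i)) ∧
    (∀ i j, M i j ∈ irrelevantIdeal) ∧
    Function.Injective M.mulVecLin ∧
    Function.Exact M.mulVecLin (Fintype.linearCombination Poly f) ∧
    LinearMap.range (Fintype.linearCombination Poly f) = I

/-- A weak admissible pair of sequences of integers. -/
structure WeakAdmissiblePair where
  length : ℕ
  two_le_length : 2 ≤ length
  a : Fin length → ℤ
  b : Fin length → ℤ
  a_monotone : Monotone a
  b_monotone : Monotone b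
  a_lt_b : ∀ i, a i < b i

namespace WeakAdmissiblePair

/-- The degree of a weak admissible pair. -/
def degree (p : WeakAdmissiblePair) : ℤ := ∑ i, (p.b i - p.a i)

/-- The pair shifted by `k`. -/
def shift (p : WeakAdmissiblePair) (k : ℤ) : WeakAdmissiblePair where
  length := p.length
  two_le_length := p.two_le_length
  a := fun i => p.a i + k
  b := fun i => p.b i + k
  a_monotone := fun _ _ h => add_le_add_left (p.a_monotone h) k
  b_monotone := fun _ _ h => add_le_add_left (p.b_monotone h) k
  a_lt_b := fun i => add_lt_add_left (p.a_lt_b i) k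

/-- Two weak admissible pairs are equivalent if one is a shift of the other. -/
def Equivalent (p q : WeakAdmissiblePair) : Prop := ∃ k : ℤ, q = p.shift k

end WeakAdmissiblePair

/-- The surface `V(F)` of degree `d` is weak determinantal of type `p`. -/
def IsWeakDeterminantalOfType (F : Poly) (d : ℕ) (p : WeakAdmissiblePair) : Prop :=
  p.degree = d ∧
    ∃ S : Matrix (Fin p.length) (Fin p.length) Poly,
      (∀ i j, IsForm (S i j) (p.b j - p.a i)) ∧
      (∀ i j, p.b j ≤ p.a i → S i j = 0) ∧
      F = S.det

/-- The surface `V(F)` of degree `d` is weak determinantal (of some type). -/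
def IsWeakDeterminantal (F : Poly) (d : ℕ) : Prop :=
  ∃ p : WeakAdmissiblePair, IsWeakDeterminantalOfType F d p

/-- The members of the family `T` are types of the weak determinantal surface `V(F)`, and up to
equivalence it has no other types. -/
def IsFamilyOfTypes {ι : Type*} (F : Poly) (d : ℕ) (T : ι → WeakAdmissiblePair) : Prop :=
  (∀ i, IsWeakDeterminantalOfType F d (T i)) ∧
    ∀ p : WeakAdmissiblePair, IsWeakDeterminantalOfType F d p → ∃ i, (T i).Equivalent p

/-- `I` has the minimal free resolution
`0 → ⨁ j, R(-(b j + k)) → (⨁ i, R(-(a i + k))) ⊕ R(-d) → I → 0`. -/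
def HasResolutionWithSurface (I : Ideal Poly) (d : ℕ) (p : WeakAdmissiblePair) (k : ℤ) : Prop :=
  HasMinimalFreeResolution I
    (Sum.elim (fun i : Fin p.length => p.a i + k) (fun _ : Unit => (d : ℤ)))
    (fun j : Fin p.length => p.b j + k)

/-- `I` has the minimal free resolution
`0 → ⨁ i ≠ j₀, R(-d + b j₀ - b i) → ⨁ i, R(-d + b j₀ - a i) → I → 0`. The degrees in it are those
of the pair shifted by `k = d - b j₀`, the shift that has the entry `d` at the place `j₀`. -/
def HasResolutionWithoutSurface (I : Ideal Poly) (d : ℕ) (p : WeakAdmissiblePair)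
    (j₀ : Fin p.length) : Prop :=
  HasMinimalFreeResolution I
    (fun i : Fin p.length => -(-(d : ℤ) + p.b j₀ - p.a i))
    (fun j : {j : Fin p.length // j ≠ j₀} => -(-(d : ℤ) + p.b j₀ - p.b j))

end ACMCurve

open ACMCurve

/-!
The curve `C` is arithmetically Cohen–Macaulay if and only if `I_C` has a free resolution of length
one, and in codimension two such a resolution is a matrix whose maximal minors are the generators
(Hilbert–Burch). The equation `F` of the surface turns this matrix into a square one with
determinant `F`, in one of two ways.

*From resolutions to the Cohen–Macaulay property.* Let `A = R ⧸ I_C`. At a maximal ideal `P` of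
`R` there is a regular sequence of length four, so that `Ext i (R ⧸ P) F` vanishes for a free module
`F` and `i < 4`. A resolution of length one of `I_C` gives the vanishing of `Ext i (R ⧸ P) A` for
`i < 2`, and by the Rees theorem a regular sequence of length two on `A` in `P`
(`exists_isRegular_of_resolution`); this is enough, as `A` has dimension two. Complete intersections
are covered by the Koszul resolution: the two generators are coprime, because an ideal of
codimension two lies in no proper principal ideal
(`exists_not_dvd_of_ringKrullDim_quotient_eq_two`).

*From the Cohen–Macaulay property to resolutions.* At the irrelevant ideal there is a regular
sequence of length two on `A`. Hence the Koszul cohomology of `A` with respect to the variables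
vanishes in degree one, which is its homology in degree three; shifting dimensions twice, the
relations between minimal generators of the syzygies of `I_C` vanish
(`injective_of_ker_le_irrelevantIdeal`). So the syzygies are free
(`Curve.IsACM.exists_resolution`), the graded form of the Auslander–Buchsbaum formula. Then
`exists_isUnit_det_adjoinColumn` says that adjoining a column `c` to the matrix `M` of the syzygies
gives the determinant `u * ∑ i, c i * f i`, where the `f i` are the generators and `u` is a unit.
If `F` is a minimal generator, it can be taken among the `f i`, and the column is the corresponding
standard vector: deleting the row of `F` from `M` leaves a square matrix with determinant `u * F`.
If not, `F = ∑ i, c i * f i` with forms `c i` without constant term, and adjoining this column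
does it. In both cases all entries lie in the irrelevant ideal; as the determinant is not zero,
the sorted degrees satisfy `a i < b i` (`lt_of_det_ne_zero`), so that they form a type of the
surface, which is a shift of a member of the family.
-/

/-! ### Regular sequences in the polynomial ring -/

namespace ACMCurve

open RingTheory.Sequence

theorem mem_span_X_image_of_X_mul_mem {σ R : Type*} [CommRing R] {s : Set σ} {i : σ}
    (hi : i ∉ s) {f : MvPolynomial σ R}
    (h : X i * f ∈ Ideal.span (X '' s : Set (MvPolynomial σ R))) :
    f ∈ Ideal.span (X '' s : Set (MvPolynomial σ R)) := by
  classical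
  rw [mem_ideal_span_X_image] at h ⊢
  intro m hm
  obtain ⟨j, hj, hne⟩ := h (Finsupp.single i 1 + m) (by
    rw [mem_support_iff, coeff_X_mul]; exact mem_support_iff.mp hm)
  refine ⟨j, hj, ?_⟩
  have : i ≠ j := fun e => hi (e ▸ hj)
  simpa [Finsupp.single_apply, this] using hne

theorem isWeaklyRegular_X (R : Type*) [CommRing R] (n : ℕ) :
    IsWeaklyRegular (MvPolynomial (Fin n) R)
      (List.ofFn (X : Fin n → MvPolynomial (Fin n) R)) := by
  rw [isWeaklyRegular_iff_Fin]
  intro i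
  rw [isSMulRegular_quotient_iff_mem_of_smul_mem]
  have key : Ideal.ofList (((List.ofFn (X : Fin n → MvPolynomial (Fin n) R))).take i) •
      (⊤ : Submodule (MvPolynomial (Fin n) R) (MvPolynomial (Fin n) R)) =
      Ideal.span (X '' {j : Fin n | (j : ℕ) < i}) := by
    rw [smul_eq_mul, Ideal.mul_top]
    unfold Ideal.ofList
    congr 1
    ext f
    change f ∈ (List.ofFn X).take i ↔ f ∈ X '' {j : Fin n | (j : ℕ) < i}
    simp only [List.mem_take_iff_getElem, List.getElem_ofFn, Set.mem_image]
    have := i.2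
    simp only [List.length_ofFn] at this
    constructor
    · rintro ⟨j, hj, rfl⟩
      exact ⟨⟨j, by simp at hj; omega⟩, by simp at hj ⊢; omega, rfl⟩
    · rintro ⟨j, hj, rfl⟩
      exact ⟨j, by simpa [-Fin.val_fin_lt] using hj, rfl⟩
  rw [key]
  intro f hf
  have hi := i.2
  simp only [List.length_ofFn] at hi
  refine mem_span_X_image_of_X_mul_mem (i := ⟨i, hi⟩) (by simp) ?_
  simpa [smul_eq_mul] using hf

/-- The translation of the affine space that moves the origin to the point `p`. -/
noncomputable def translation {σ R : Type*} [CommRing R] (p : σ → R) :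
    MvPolynomial σ R ≃ₐ[R] MvPolynomial σ R :=
  AlgEquiv.ofAlgHom (aeval fun i => X i - C (p i)) (aeval fun i => X i + C (p i))
    (by ext i; simp) (by ext i; simp)

theorem isWeaklyRegular_X_sub_C {R : Type*} [CommRing R] {n : ℕ} (p : Fin n → R) :
    IsWeaklyRegular (MvPolynomial (Fin n) R)
      (List.ofFn fun i => (X i - C (p i) : MvPolynomial (Fin n) R)) := by
  refine ((translation p).toAddEquiv.isWeaklyRegular_congr (as := List.ofFn X) ?_).mp
    (isWeaklyRegular_X R n)
  rw [List.forall₂_iff_get]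
  refine ⟨by simp, fun i h1 h2 x => ?_⟩
  simp [translation]

/-- By the Nullstellensatz, every maximal ideal of `ℂ[x₁, …, xₙ]` contains a regular sequence of
length `n`. -/
theorem exists_isWeaklyRegular_of_isMaximal {n : ℕ} (M : Ideal (MvPolynomial (Fin n) ℂ))
    (hM : M.IsMaximal) :
    ∃ rs : List (MvPolynomial (Fin n) ℂ), rs.length = n ∧ (∀ r ∈ rs, r ∈ M) ∧
      IsWeaklyRegular (MvPolynomial (Fin n) ℂ) rs := by
  obtain ⟨p, rfl⟩ := isMaximal_iff_eq_vanishingIdeal_singleton.mp hM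
  refine ⟨_, by simp, ?_, isWeaklyRegular_X_sub_C p⟩
  intro r hr
  rw [List.mem_ofFn] at hr
  obtain ⟨i, rfl⟩ := hr
  simp

theorem length_le_height_of_isWeaklyRegular {A : Type*} [CommRing A] [IsNoetherianRing A]
    (P : Ideal A) [P.IsPrime] {rs : List A} (hrs : IsWeaklyRegular A rs) (hP : ∀ r ∈ rs, r ∈ P) :
    (rs.length : ℕ∞) ≤ P.height := by
  have h := hrs.isRegular_of_isLocalization_of_mem (Localization.AtPrime P) P hP
  have h2 := ringKrullDim_add_length_eq_ringKrullDim_of_isRegular _ h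
  rw [IsLocalization.AtPrime.ringKrullDim_eq_height P (Localization.AtPrime P)] at h2
  have : Nontrivial (Localization.AtPrime P ⧸
      Ideal.ofList (rs.map (algebraMap A (Localization.AtPrime P)))) := by
    refine Ideal.Quotient.nontrivial_iff.mpr fun e => h.2 ?_
    rw [e]; simp
  have h3 : (0 : WithBot ℕ∞) ≤ ringKrullDim (Localization.AtPrime P ⧸
      Ideal.ofList (rs.map (algebraMap A (Localization.AtPrime P)))) :=
    ringKrullDim_nonneg_of_nontrivial
  have h4 : ((rs.length : ℕ∞) : WithBot ℕ∞) ≤ (P.height : WithBot ℕ∞) := by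
    rw [← h2]
    simpa using add_le_add_left h3 ((rs.length : WithBot ℕ∞))
  exact_mod_cast h4

theorem le_height_of_isMaximal {n : ℕ} (M : Ideal (MvPolynomial (Fin n) ℂ)) (hM : M.IsMaximal) :
    (n : ℕ∞) ≤ M.height := by
  obtain ⟨rs, h1, h2, h3⟩ := exists_isWeaklyRegular_of_isMaximal M hM
  have := hM.isPrime
  simpa [h1] using length_le_height_of_isWeaklyRegular M h3 h2

/-- A hypersurface in affine `(n + 1)`-space has dimension at least `n`. -/
theorem le_ringKrullDim_quotient_span_singleton {n : ℕ} {p : MvPolynomial (Fin (n + 1)) ℂ}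
    (hp : ¬ IsUnit p) :
    (n : WithBot ℕ∞) ≤ ringKrullDim (MvPolynomial (Fin (n + 1)) ℂ ⧸ Ideal.span {p}) := by
  obtain ⟨M, hM, hpM⟩ := exists_max_ideal_of_mem_nonunits hp
  have := hM.isPrime
  have h1 := Ideal.height_le_ringKrullDim_quotient_add_one hpM
  have h2 : (((n + 1 : ℕ) : ℕ∞) : WithBot ℕ∞) ≤ (M.height : WithBot ℕ∞) := by
    exact_mod_cast le_height_of_isMaximal M hM
  have h3 := h2.trans h1
  have h4 : (n : WithBot ℕ∞) + 1 ≤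
    ringKrullDim (MvPolynomial (Fin (n + 1)) ℂ ⧸ Ideal.span {p}) + 1 := by simpa using h3
  exact ENat.WithBot.add_le_add_one_right_iff.mp h4

/-- The generators of an ideal of codimension at least two have no common factor. -/
theorem exists_not_dvd_of_ringKrullDim_quotient_eq_two {I : Ideal Poly}
    (hI : ringKrullDim (Poly ⧸ I) = 2) {p : Poly} (hp : ¬ IsUnit p) :
    ∃ f ∈ I, ¬ p ∣ f := by
  by_contra! h
  have hle : I ≤ Ideal.span {p} := fun f hf => Ideal.mem_span_singleton.mpr (h f hf)
  have h1 := le_ringKrullDim_quotient_span_singleton hp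
  have h2 := ringKrullDim_le_of_surjective (Ideal.Quotient.factor hle)
    (Ideal.Quotient.factor_surjective hle)
  rw [hI] at h2
  have h3 : ((3 : ℕ) : WithBot ℕ∞) ≤ 2 := h1.trans h2
  exact absurd (by exact_mod_cast h3) (by norm_num : ¬ (3 ≤ 2))

end ACMCurve

/-! ### Ideals with a free resolution of length one are Cohen–Macaulay in codimension two -/

namespace ACMCurve

open RingTheory.Sequence CategoryTheory Abelian

theorem subsingleton_ext_of_exact {R : Type} [CommRing R] (X : ModuleCat.{0} R)
    {M₁ M₂ M₃ : Type} [AddCommGroup M₁] [AddCommGroup M₂] [AddCommGroup M₃] [Module R M₁]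
    [Module R M₂] [Module R M₃] (f : M₁ →ₗ[R] M₂) (g : M₂ →ₗ[R] M₃)
    (hf : Function.Injective f) (hfg : Function.Exact f g) (hg : Function.Surjective g) (n : ℕ)
    (h₂ : Subsingleton (Ext X (ModuleCat.of R M₂) n))
    (h₁ : Subsingleton (Ext X (ModuleCat.of R M₁) (n + 1))) :
    Subsingleton (Ext X (ModuleCat.of R M₃) n) := by
  let S : ShortComplex (ModuleCat.{0} R) :=
    ShortComplex.mk (ModuleCat.ofHom f) (ModuleCat.ofHom g) (by
      ext x; exact hfg.apply_apply_eq_zero x)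
  have hS : S.ShortExact :=
    { exact := (ShortComplex.ShortExact.moduleCat_exact_iff_function_exact S).mpr hfg
      mono_f := (ModuleCat.mono_iff_injective _).mpr hf
      epi_g := (ModuleCat.epi_iff_surjective _).mpr hg }
  have zero1 := AddCommGrpCat.isZero_of_iff_subsingleton.mpr h₂
  have zero2 := AddCommGrpCat.isZero_of_iff_subsingleton.mpr h₁
  exact AddCommGrpCat.subsingleton_of_isZero <| ShortComplex.Exact.isZero_of_both_zeros
    (Ext.covariant_sequence_exact₃' X hS n (n + 1) rfl)
    (zero1.eq_zero_of_src _) (zero2.eq_zero_of_tgt _)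

theorem isWeaklyRegular_pi {R κ : Type} [CommRing R] [Finite κ] {rs : List R}
    (h : IsWeaklyRegular R rs) : IsWeaklyRegular (κ → R) rs :=
  ((TensorProduct.rid R (κ → R)).isWeaklyRegular_congr rs).mp (h.isWeaklyRegular_lTensor)

theorem subsingleton_ext_pi {R κ : Type} [CommRing R] [IsNoetherianRing R] [Finite κ]
    {M : Ideal R} (hM : M ≠ ⊤) {rs : List R} (h : IsWeaklyRegular R rs)
    (hrs : ∀ r ∈ rs, r ∈ M) {i : ℕ} (hi : i < rs.length) :
    Subsingleton (Ext (ModuleCat.of R (R ⧸ M)) (ModuleCat.of R (κ → R)) i) := by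
  cases isEmpty_or_nonempty κ with
  | inl hκ =>
    refine ⟨fun x y => ?_⟩
    have hz : Limits.IsZero (ModuleCat.of R (κ → R)) :=
      ModuleCat.isZero_of_subsingleton _
    have h0 : ∀ z : Ext (ModuleCat.of R (R ⧸ M)) (ModuleCat.of R (κ → R)) i, z = 0 := fun z => by
      rw [← z.comp_mk₀_id, hz.eq_zero_of_src (𝟙 _)]; simp
    rw [h0 x, h0 y]
  | inr hκ =>
    have hlt : M • (⊤ : Submodule R (κ → R)) < ⊤ := by
      obtain ⟨k⟩ := hκ
      refine lt_top_iff_ne_top.mpr fun e => hM ?_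
      have h1 : Submodule.map (LinearMap.proj k : (κ → R) →ₗ[R] R) (M • ⊤) = ⊤ := by
        rw [e, Submodule.map_top, LinearMap.range_eq_top]
        exact LinearMap.proj_surjective k
      rw [Submodule.map_smul'', Submodule.map_top,
        LinearMap.range_eq_top.mpr (LinearMap.proj_surjective k)] at h1
      simpa using h1
    refine ModuleCat.subsingleton_ext_of_exists_isRegular M _ ?_ _ hlt rs hrs
      ⟨isWeaklyRegular_pi h, ?_⟩ i hi
    · rw [Module.support_eq_zeroLocus, Ideal.annihilator_quotient]
    · intro e
      refine hlt.not_ge (e.le.trans (Submodule.smul_mono_left ?_))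
      exact Ideal.span_le.mpr fun r hr => hrs r hr

/-- If `I` has a free resolution of length one, then `depth R ⧸ I ≥ n - 2` at every maximal ideal,
where `n` is the depth of `R`: by the Rees theorem it is enough to follow the vanishing of
`Ext (R ⧸ M) -` through the two short exact sequences of the resolution. -/
theorem exists_isRegular_of_resolution {R ι κ : Type} [CommRing R] [IsNoetherianRing R]
    [Finite ι] [Finite κ] {I : Ideal R} {M : Ideal R} (hM : M ≠ ⊤) (hIM : I ≤ M) {n : ℕ}
    {rs : List R} (hlen : rs.length = n + 2) (hrs : IsWeaklyRegular R rs) (hmem : ∀ r ∈ rs, r ∈ M)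
    (φ : (ι → R) →ₗ[R] R) (ψ : (κ → R) →ₗ[R] (ι → R)) (hψ : Function.Injective ψ)
    (hex : Function.Exact ψ φ) (hφ : LinearMap.range φ = I) :
    ∃ ss : List R, ss.length = n ∧ (∀ r ∈ ss, r ∈ M) ∧ IsRegular (R ⧸ I) ss := by
  have e1 : ∀ i < n + 1, Subsingleton (Ext (ModuleCat.of R (R ⧸ M)) (ModuleCat.of R I) i) := by
    intro i hi
    refine subsingleton_ext_of_exact _ ψ
      (φ.codRestrict I fun x => hφ ▸ LinearMap.mem_range_self φ x) hψ ?_ ?_ i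
      (subsingleton_ext_pi hM hrs hmem (by omega)) (subsingleton_ext_pi hM hrs hmem (by omega))
    · intro x
      rw [← hex x]
      exact Subtype.ext_iff
    · rintro ⟨x, hx⟩
      rw [← hφ] at hx
      obtain ⟨y, rfl⟩ := hx
      exact ⟨y, rfl⟩
  have e2 : ∀ i < n + 1, Subsingleton (Ext (ModuleCat.of R (R ⧸ M)) (ModuleCat.of R R) i) := by
    intro i hi
    have h := subsingleton_ext_pi (κ := Unit) hM hrs hmem (i := i) (by omega)
    have h' : Subsingleton
        (Ext (ModuleCat.of R (R ⧸ M)) (ModuleCat.of R (PEmpty → R)) (i + 1)) :=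
      subsingleton_ext_pi hM hrs hmem (by omega)
    refine subsingleton_ext_of_exact _ (0 : (PEmpty → R) →ₗ[R] (Unit → R))
      (LinearEquiv.funUnique Unit R R).toLinearMap (Function.injective_of_subsingleton _) ?_
      (LinearEquiv.surjective _) i h h'
    intro x
    simp only [LinearMap.zero_apply, Set.mem_range, exists_const]
    exact ⟨fun h => funext fun _ => h.symm, fun h => (congrFun h ()).symm⟩
  have e3 : ∀ i < n, Subsingleton (Ext (ModuleCat.of R (R ⧸ M)) (ModuleCat.of R (R ⧸ I)) i) :=
    fun i hi => subsingleton_ext_of_exact _ I.subtype I.mkQ (Submodule.subtype_injective _)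
      (LinearMap.exact_subtype_mkQ _) (Submodule.mkQ_surjective _) i (e2 i (by omega))
      (e1 (i + 1) (by omega))
  refine ModuleCat.exists_isRegular_of_exists_subsingleton_ext M n (ModuleCat.of R (R ⧸ I)) ?_
    (ModuleCat.of R (R ⧸ M)) ?_ e3
  · refine lt_top_iff_ne_top.mpr fun e => hM ?_
    have h1 : (M • ⊤ : Submodule R (R ⧸ I)) = Submodule.map I.mkQ M := by
      rw [← I.range_mkQ, ← Submodule.map_top, ← Submodule.map_smul'', smul_eq_mul, Ideal.mul_top]
    have h2 : (I.mkQ 1 : R ⧸ I) ∈ Submodule.map I.mkQ M := by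
      rw [← h1]; exact e.ge trivial
    obtain ⟨m, hm, h3⟩ := h2
    rw [Submodule.mkQ_apply, Submodule.mkQ_apply, Submodule.Quotient.eq] at h3
    rw [Ideal.eq_top_iff_one]
    simpa using sub_mem hm (hIM h3)
  · rw [Module.support_eq_zeroLocus, Ideal.annihilator_quotient]

theorem isCohenMacaulay_of_resolution {ι κ : Type} [Finite ι] [Finite κ] {I : Ideal Poly}
    (hI : ringKrullDim (Poly ⧸ I) = 2)
    (φ : (ι → Poly) →ₗ[Poly] Poly) (ψ : (κ → Poly) →ₗ[Poly] (ι → Poly))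
    (hψ : Function.Injective ψ) (hex : Function.Exact ψ φ) (hφ : LinearMap.range φ = I) :
    IsCohenMacaulay (Poly ⧸ I) := by
  refine ⟨inferInstance, fun P hP => ?_⟩
  have hPp := hP.isPrime
  have hM := Ideal.comap_isMaximal_of_surjective (Ideal.Quotient.mk I)
    Ideal.Quotient.mk_surjective (K := P)
  obtain ⟨rs, h1, h2, h3⟩ := exists_isWeaklyRegular_of_isMaximal _ hM
  have hIM : I ≤ P.comap (Ideal.Quotient.mk I) := fun x hx => by
    rw [Ideal.mem_comap, Ideal.Quotient.eq_zero_iff_mem.mpr hx]; exact P.zero_mem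
  obtain ⟨ss, g1, g2, g3⟩ := exists_isRegular_of_resolution hM.ne_top hIM (n := 2) h1 h3 h2 φ ψ
    hψ hex hφ
  have g4 : IsWeaklyRegular (Poly ⧸ I) (ss.map (algebraMap Poly (Poly ⧸ I))) :=
    (isWeaklyRegular_map_algebraMap_iff _ _ _).mpr g3.1
  have g5 : ∀ r ∈ ss.map (algebraMap Poly (Poly ⧸ I)), r ∈ P := by
    intro r hr
    obtain ⟨s, hs, rfl⟩ := List.mem_map.mp hr
    exact g2 s hs
  refine ⟨_, g5, ⟨g4, fun e => hP.ne_top (top_le_iff.mp ?_)⟩, le_antisymm ?_ ?_⟩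
  · rw [smul_eq_mul, Ideal.mul_top] at e
    rw [e]
    exact Ideal.span_le.mpr g5
  · exact length_le_height_of_isWeaklyRegular P g4 g5
  · have h := Ideal.height_le_ringKrullDim_of_ne_top hP.ne_top
    rw [hI] at h
    rw [List.length_map, g1]
    exact WithBot.coe_le_coe.mp (h : (P.height : WithBot ℕ∞) ≤ ((2 : ℕ∞) : WithBot ℕ∞))

/-- Two generators of an ideal of codimension two form a regular sequence, and their Koszul complex
resolves the ideal. -/
theorem Curve.IsCompleteIntersection.isACM {C : Curve} (h : C.IsCompleteIntersection) :
    C.IsACM := by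
  obtain ⟨f, g, -, -, -, -, hfg⟩ := h
  have hcop : IsRelPrime f g := by
    intro p hpf hpg
    by_contra hp
    obtain ⟨q, hq, hpq⟩ := exists_not_dvd_of_ringKrullDim_quotient_eq_two C.dim_eq hp
    rw [hfg, Ideal.mem_span_pair] at hq
    obtain ⟨a, b, rfl⟩ := hq
    exact hpq (dvd_add (hpf.mul_left a) (hpg.mul_left b))
  have hne : f ≠ 0 ∨ g ≠ 0 := by
    by_contra! h0
    obtain ⟨rfl, rfl⟩ := h0
    exact X_ne_zero (R := ℂ) (0 : Fin 4)
      (zero_dvd_iff.mp ((hcop (dvd_zero (0 : Poly)) (dvd_zero _)).dvd))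
  refine isCohenMacaulay_of_resolution C.dim_eq
    (LinearMap.toSpanSingleton Poly Poly f ∘ₗ LinearMap.proj (0 : Fin 2) +
      LinearMap.toSpanSingleton Poly Poly g ∘ₗ LinearMap.proj (1 : Fin 2))
    (LinearMap.pi fun i : Fin 2 => LinearMap.toSpanSingleton Poly Poly (![g, -f] i) ∘ₗ
      LinearMap.proj (0 : Fin 1)) ?_ ?_ ?_
  · rw [← LinearMap.ker_eq_bot, LinearMap.ker_eq_bot']
    intro c hc
    refine funext fun i => ?_
    have h0 := congrFun hc 0
    have h1 := congrFun hc 1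
    simp at h0 h1
    rw [Subsingleton.elim i 0, Pi.zero_apply]
    tauto
  · intro v
    simp only [LinearMap.add_apply, LinearMap.comp_apply, LinearMap.proj_apply,
      LinearMap.toSpanSingleton_apply, smul_eq_mul, Set.mem_range]
    constructor
    · intro h
      have hg : g ∣ v 0 := hcop.symm.dvd_of_dvd_mul_right ⟨-v 1, by linear_combination h⟩
      have hf : f ∣ v 1 := hcop.dvd_of_dvd_mul_right ⟨-v 0, by linear_combination h⟩
      obtain ⟨c, hc⟩ := hg
      obtain ⟨e, he⟩ := hf
      rw [hc, he] at h
      rcases hne with h0 | h0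
      · by_cases hg0 : g = 0
        · have hu : IsUnit f := hcop dvd_rfl (hg0 ▸ dvd_zero f)
          refine ⟨fun _ => -e, ?_⟩
          ext i
          fin_cases i <;> simp [hc, he, hg0, mul_comm]
        · have hce : c + e = 0 := by
            have : f * g * (c + e) = 0 := by linear_combination h
            simpa [h0, hg0] using this
          refine ⟨fun _ => c, ?_⟩
          ext i
          fin_cases i
          · simp [hc, mul_comm]
          · simp [he, eq_neg_of_add_eq_zero_right hce, mul_comm]
      · by_cases hf0 : f = 0
        · refine ⟨fun _ => c, ?_⟩
          ext i
          fin_cases i <;> simp [hc, he, hf0, mul_comm]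
        · have hce : c + e = 0 := by
            have : f * g * (c + e) = 0 := by linear_combination h
            simpa [h0, hf0] using this
          refine ⟨fun _ => c, ?_⟩
          ext i
          fin_cases i
          · simp [hc, mul_comm]
          · simp [he, eq_neg_of_add_eq_zero_right hce, mul_comm]
    · rintro ⟨c, rfl⟩
      simp
      ring
  · rw [hfg]
    ext q
    rw [Ideal.mem_span_pair, LinearMap.mem_range]
    constructor
    · rintro ⟨v, rfl⟩
      exact ⟨v 0, v 1, by simp⟩
    · rintro ⟨a, b, rfl⟩
      exact ⟨![a, b], by simp⟩

theorem Curve.isACM_of_hasMinimalFreeResolution {C : Curve} {ι κ : Type} [Fintype ι] [Fintype κ]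
    {α : ι → ℤ} {β : κ → ℤ} (h : HasMinimalFreeResolution C.ideal α β) : C.IsACM := by
  obtain ⟨f, M, -, -, -, h1, h2, h3⟩ := h
  exact isCohenMacaulay_of_resolution C.dim_eq _ _ h1 h2 h3

end ACMCurve

/-! ### The dimension of a graded ring at the irrelevant ideal -/

namespace ACMCurve

theorem mem_irrelevantIdeal_iff {p : Poly} : p ∈ irrelevantIdeal ↔ coeff 0 p = 0 := by
  rw [irrelevantIdeal, ← Set.image_univ, mem_ideal_span_X_image]
  constructor
  · intro h
    by_contra h0
    obtain ⟨i, -, hi⟩ := h 0 (mem_support_iff.mpr h0)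
    exact hi rfl
  · intro h m hm
    have : m ≠ 0 := fun e => mem_support_iff.mp hm (e ▸ h)
    obtain ⟨i, hi⟩ := Finsupp.ne_iff.mp this
    exact ⟨i, trivial, hi⟩

theorem irrelevantIdeal_isMaximal : irrelevantIdeal.IsMaximal := by
  have h : irrelevantIdeal = RingHom.ker (constantCoeff : Poly →+* ℂ) := by
    ext p
    rw [mem_irrelevantIdeal_iff, RingHom.mem_ker, constantCoeff_eq]
  rw [h]
  exact RingHom.ker_isMaximal_of_surjective _ fun c => ⟨C c, constantCoeff_C _ c⟩

theorem le_irrelevantIdeal {I : Ideal Poly}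
    (hom : ∀ f ∈ I, ∀ n : ℕ, homogeneousComponent n f ∈ I) (hI : I ≠ ⊤) :
    I ≤ irrelevantIdeal := by
  intro f hf
  rw [mem_irrelevantIdeal_iff]
  by_contra h0
  have h := hom f hf 0
  rw [homogeneousComponent_zero] at h
  exact hI (Ideal.eq_top_of_isUnit_mem _ h ((Ne.isUnit h0).map C))

/-- A prime that is minimal over a homogeneous ideal is homogeneous, as its homogeneous core is a
prime in between. -/
theorem homogeneousComponent_mem_of_mem_minimalPrimes {I Q : Ideal Poly}
    (hom : ∀ f ∈ I, ∀ n : ℕ, homogeneousComponent n f ∈ I) (hQ : Q ∈ I.minimalPrimes) :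
    ∀ f ∈ Q, ∀ n : ℕ, homogeneousComponent n f ∈ Q := by
  classical
  let := MvPolynomial.gradedAlgebra (σ := Fin 4) (R := ℂ)
  have hQp : Q.IsPrime := hQ.1.1
  have h1 : (Q.homogeneousCore (homogeneousSubmodule (Fin 4) ℂ)).toIdeal.IsPrime :=
    hQp.homogeneousCore
  have h2 : I ≤ (Q.homogeneousCore (homogeneousSubmodule (Fin 4) ℂ)).toIdeal := by
    intro f hf
    rw [← sum_homogeneousComponent f]
    refine Ideal.sum_mem _ fun n _ => Ideal.mem_homogeneousCore_of_homogeneous_of_mem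
      ⟨n, homogeneousComponent_mem n f⟩ (hQ.1.2 (hom f hf n))
  have h3 : Q ≤ (Q.homogeneousCore (homogeneousSubmodule (Fin 4) ℂ)).toIdeal :=
    hQ.2 ⟨h1, h2⟩ (Ideal.toIdeal_homogeneousCore_le _ _)
  have h4 : Q.IsHomogeneous (homogeneousSubmodule (Fin 4) ℂ) := by
    rw [Ideal.IsHomogeneous.iff_eq]
    exact le_antisymm (Ideal.toIdeal_homogeneousCore_le _ _) h3
  intro f hf n
  exact homogeneousComponent_mem_of_mem h4 hf n

/-- All maximal ideals of an affine domain over `ℂ` have the same height: by Noether normalization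
and going down, they are as high as maximal ideals of a polynomial ring. -/
theorem ringKrullDim_le_height_of_isMaximal {B : Type*} [CommRing B] [IsDomain B] [Algebra ℂ B]
    [Algebra.FiniteType ℂ B] (P : Ideal B) (hP : P.IsMaximal) :
    ringKrullDim B ≤ P.height := by
  obtain ⟨s, g, hg, hint⟩ := exists_integral_inj_algHom_of_fg ℂ B
  let := g.toRingHom.toAlgebra
  have : Algebra.IsIntegral (MvPolynomial (Fin s) ℂ) B := ⟨hint⟩
  have : FaithfulSMul (MvPolynomial (Fin s) ℂ) B :=
    (faithfulSMul_iff_algebraMap_injective _ _).mpr hg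
  have : IsNoetherianRing B := Algebra.FiniteType.isNoetherianRing ℂ B
  have hmono : StrictMono (PrimeSpectrum.comap (algebraMap (MvPolynomial (Fin s) ℂ) B)) :=
    fun I J hIJ => Ideal.IsIntegral.comap_lt_comap hIJ
  have h1 : ringKrullDim B ≤ s := by
    refine (Order.krullDim_le_of_strictMono _ hmono).trans ?_
    have := MvPolynomial.ringKrullDim_of_isNoetherianRing (R := ℂ) (ι := Fin s)
    rw [ringKrullDim_eq_zero_of_field, Nat.card_fin, zero_add] at this
    exact this.le
  have h2 := Ideal.height_eq_height_add_of_liesOver_of_hasGoingDown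
    (P.under (MvPolynomial (Fin s) ℂ)) P
  have h3 : (s : ℕ∞) ≤ P.height := by
    rw [h2]
    exact (le_height_of_isMaximal _ inferInstance).trans le_self_add
  exact h1.trans (by exact_mod_cast h3)

/-- The dimension of a graded ring is attained at the irrelevant ideal, since all minimal primes
are contained in it. -/
theorem ringKrullDim_le_height_irrelevantIdeal {I : Ideal Poly}
    (hom : ∀ f ∈ I, ∀ n : ℕ, homogeneousComponent n f ∈ I) {n : ℕ}
    (hI : (n : WithBot ℕ∞) ≤ ringKrullDim (Poly ⧸ I)) :
    (n : ℕ∞) ≤ (irrelevantIdeal.map (Ideal.Quotient.mk I)).height := by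
  rw [ringKrullDim_quotient, Order.le_krullDim_iff] at hI
  obtain ⟨l, hl⟩ := hI
  have hI0 : I ≤ l.head.1.asIdeal := l.head.2
  have hp : l.head.1.asIdeal.IsPrime := l.head.1.isPrime
  obtain ⟨Q, hQ, hQl⟩ := Ideal.exists_minimalPrimes_le hI0
  have hQp : Q.IsPrime := hQ.1.1
  have hQI : Q ≤ irrelevantIdeal :=
    le_irrelevantIdeal (homogeneousComponent_mem_of_mem_minimalPrimes hom hQ) hQp.ne_top
  have hmax := irrelevantIdeal_isMaximal
  have h1 : (n : WithBot ℕ∞) ≤ ringKrullDim (Poly ⧸ Q) := by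
    rw [ringKrullDim_quotient, Order.le_krullDim_iff]
    refine ⟨⟨l.length, fun i => ⟨(l i).1, hQl.trans ?_⟩, fun i => l.step i⟩, hl⟩
    exact (l.head_le i : l.head ≤ l i)
  have hBmax : (irrelevantIdeal.map (Ideal.Quotient.mk Q)).IsMaximal :=
    Ideal.IsMaximal.map_of_surjective_of_ker_le Ideal.Quotient.mk_surjective
      (by rwa [Ideal.mk_ker])
  have h2 := h1.trans (ringKrullDim_le_height_of_isMaximal _ hBmax)
  have h3 : (n : ℕ∞) ≤ (irrelevantIdeal.map (Ideal.Quotient.mk Q)).height := by exact_mod_cast h2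
  have hprime := hBmax.isPrime
  refine h3.trans ?_
  have hsurj := Ideal.Quotient.factor_surjective hQ.1.2
  have h := Order.height_le_height_apply_of_strictMono _
    (RingHom.strictMono_comap_of_surjective hsurj)
    (⟨irrelevantIdeal.map (Ideal.Quotient.mk Q), inferInstance⟩ : PrimeSpectrum (Poly ⧸ Q))
  rw [← PrimeSpectrum.height_eq_orderHeight, ← PrimeSpectrum.height_eq_orderHeight] at h
  refine h.trans (le_of_eq ?_)
  congr 1
  have e1 : irrelevantIdeal.map (Ideal.Quotient.mk Q) =
      (irrelevantIdeal.map (Ideal.Quotient.mk I)).map (Ideal.Quotient.factor hQ.1.2) := by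
    rw [Ideal.map_map, Ideal.Quotient.factor_comp_mk]
  rw [PrimeSpectrum.comap_asIdeal]
  dsimp only
  rw [e1, Ideal.comap_map_of_surjective' _ hsurj, sup_eq_left, Ideal.Quotient.factor_ker]
  exact Ideal.map_mono hQI

/-- The depth condition at the irrelevant ideal that is used for a curve: a regular sequence of
length two, spelled out in terms of elements. -/
theorem Curve.IsACM.exists_regular_pair {C : Curve} (h : C.IsACM) :
    ∃ r₁ ∈ irrelevantIdeal, ∃ r₂ ∈ irrelevantIdeal,
      (∀ a, r₁ * a ∈ C.ideal → a ∈ C.ideal) ∧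
      (∀ a b, r₂ * a - r₁ * b ∈ C.ideal → ∃ c, a - r₁ * c ∈ C.ideal) := by
  have hne : C.ideal ≠ ⊤ := by
    intro e
    have h1 := C.dim_eq
    have : Subsingleton (Poly ⧸ C.ideal) := Ideal.Quotient.subsingleton_iff.mpr e
    rw [ringKrullDim_eq_bot_of_subsingleton] at h1
    exact absurd h1 (by decide)
  have hle := le_irrelevantIdeal C.homogeneous hne
  have hmax := irrelevantIdeal_isMaximal
  have hPmax : (irrelevantIdeal.map (Ideal.Quotient.mk C.ideal)).IsMaximal :=
    Ideal.IsMaximal.map_of_surjective_of_ker_le Ideal.Quotient.mk_surjective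
      (by rwa [Ideal.mk_ker])
  obtain ⟨rs, h1, h2, h3⟩ := h.2 _ hPmax
  have h4 := ringKrullDim_le_height_irrelevantIdeal C.homogeneous (n := 2) C.dim_eq.ge
  rw [← h3] at h4
  have h5 : 2 ≤ rs.length := by exact_mod_cast h4
  match rs, h5 with
  | s₁ :: s₂ :: ss, _ =>
    have hmem : ∀ s ∈ s₁ :: s₂ :: ss, ∃ r ∈ irrelevantIdeal, Ideal.Quotient.mk C.ideal r = s :=
      fun s hs => (Ideal.mem_map_iff_of_surjective _ Ideal.Quotient.mk_surjective).mp (h1 s hs)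
    obtain ⟨r₁, m₁, rfl⟩ := hmem s₁ (by simp)
    obtain ⟨r₂, m₂, rfl⟩ := hmem s₂ (by simp)
    have h6 := h2.1
    rw [RingTheory.Sequence.isWeaklyRegular_cons_iff,
      RingTheory.Sequence.isWeaklyRegular_cons_iff] at h6
    obtain ⟨g1, g2, -⟩ := h6
    refine ⟨r₁, m₁, r₂, m₂, fun a ha => ?_, fun a b hab => ?_⟩
    · rw [← Ideal.Quotient.eq_zero_iff_mem] at ha ⊢
      apply g1
      simpa using ha
    · have := (isSMulRegular_quotient_iff_mem_of_smul_mem _ _).mp g2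
        (Ideal.Quotient.mk C.ideal a) (by
        rw [Submodule.mem_smul_pointwise_iff_exists]
        refine ⟨Ideal.Quotient.mk C.ideal b, trivial, ?_⟩
        rw [smul_eq_mul, smul_eq_mul, ← map_mul, ← map_mul, eq_comm, Ideal.Quotient.eq]
        exact hab)
      rw [Submodule.mem_smul_pointwise_iff_exists] at this
      obtain ⟨c, -, hc⟩ := this
      obtain ⟨c, rfl⟩ := Ideal.Quotient.mk_surjective c
      refine ⟨c, ?_⟩
      rw [smul_eq_mul, ← map_mul, eq_comm, Ideal.Quotient.eq] at hc
      exact hc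

end ACMCurve

/-! ### Koszul relations and the freeness of the syzygies -/

namespace ACMCurve

theorem koszul_exact_one_of_two {v₀ v₁ : Poly} (h : X 0 * v₀ + X 1 * v₁ = 0) :
    ∃ c, v₀ = -(X 1 * c) ∧ v₁ = X 0 * c := by
  have h1 : v₁ ∈ Ideal.span (X '' {0} : Set Poly) := by
    refine mem_span_X_image_of_X_mul_mem (i := 1) (by decide) ?_
    rw [Set.image_singleton, Ideal.mem_span_singleton]
    exact ⟨-v₀, by linear_combination h⟩
  rw [Set.image_singleton, Ideal.mem_span_singleton] at h1
  obtain ⟨c, rfl⟩ := h1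
  refine ⟨c, ?_, rfl⟩
  have : X 0 * (v₀ + X 1 * c) = 0 := by linear_combination h
  rcases mul_eq_zero.mp this with h2 | h2
  · exact absurd h2 (X_ne_zero _)
  · linear_combination h2

theorem koszul_exact_one_of_three {v₀ v₁ v₂ : Poly}
    (h : X 0 * v₀ + X 1 * v₁ + X 2 * v₂ = 0) :
    ∃ u₀₁ u₀₂ u₁₂ : Poly, v₀ = X 1 * u₀₁ + X 2 * u₀₂ ∧ v₁ = -(X 0 * u₀₁) + X 2 * u₁₂ ∧
      v₂ = -(X 0 * u₀₂) - X 1 * u₁₂ := by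
  have h1 : v₂ ∈ Ideal.span (X '' {0, 1} : Set Poly) := by
    refine mem_span_X_image_of_X_mul_mem (i := 2) (by decide) ?_
    rw [Set.image_pair, Ideal.mem_span_pair]
    exact ⟨-v₀, -v₁, by linear_combination -h⟩
  rw [Set.image_pair, Ideal.mem_span_pair] at h1
  obtain ⟨a, b, rfl⟩ := h1
  obtain ⟨c, hc, hd⟩ := koszul_exact_one_of_two (v₀ := v₀ + X 2 * a) (v₁ := v₁ + X 2 * b)
    (by linear_combination h)
  exact ⟨-c, -a, -b, by linear_combination hc, by linear_combination hd, by ring⟩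

theorem koszul_exact_one {v₀ v₁ v₂ v₃ : Poly}
    (h : X 0 * v₀ + X 1 * v₁ + X 2 * v₂ + X 3 * v₃ = 0) :
    ∃ u₀₁ u₀₂ u₀₃ u₁₂ u₁₃ u₂₃ : Poly, v₀ = X 1 * u₀₁ + X 2 * u₀₂ + X 3 * u₀₃ ∧
      v₁ = -(X 0 * u₀₁) + X 2 * u₁₂ + X 3 * u₁₃ ∧
      v₂ = -(X 0 * u₀₂) - X 1 * u₁₂ + X 3 * u₂₃ ∧
      v₃ = -(X 0 * u₀₃) - X 1 * u₁₃ - X 2 * u₂₃ := by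
  have h1 : v₃ ∈ Ideal.span (X '' {0, 1, 2} : Set Poly) := by
    refine mem_span_X_image_of_X_mul_mem (i := 3) (by decide) ?_
    rw [Set.image_insert_eq, Set.image_pair, Ideal.mem_span_insert]
    refine ⟨-v₀, -(X 1 * v₁ + X 2 * v₂), Ideal.mem_span_pair.mpr ⟨-v₁, -v₂, by ring⟩, ?_⟩
    linear_combination h
  rw [Set.image_insert_eq, Set.image_pair, Ideal.mem_span_insert] at h1
  obtain ⟨a, z, hz, rfl⟩ := h1
  obtain ⟨b, c, rfl⟩ := Ideal.mem_span_pair.mp hz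
  obtain ⟨p, q, r, h2, h3, h4⟩ := koszul_exact_one_of_three (v₀ := v₀ + X 3 * a)
    (v₁ := v₁ + X 3 * b) (v₂ := v₂ + X 3 * c) (by linear_combination h)
  exact ⟨p, q, -a, r, -b, -c, by linear_combination h2, by linear_combination h3,
    by linear_combination h4, by ring⟩

/-- The relation for the first variable, `X 1 * w₀₁ + X 2 * w₀₂ + X 3 * w₀₃ = 0`, follows from the
other three. -/
theorem koszul_exact_two {w₀₁ w₀₂ w₀₃ w₁₂ w₁₃ w₂₃ : Poly}
    (h₁ : -(X 0 * w₀₁) + X 2 * w₁₂ + X 3 * w₁₃ = 0)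
    (h₂ : -(X 0 * w₀₂) - X 1 * w₁₂ + X 3 * w₂₃ = 0)
    (h₃ : -(X 0 * w₀₃) - X 1 * w₁₃ - X 2 * w₂₃ = 0) :
    ∃ a b c d : Poly, w₀₁ = X 2 * a + X 3 * b ∧ w₀₂ = -(X 1 * a) + X 3 * c ∧
      w₀₃ = -(X 1 * b) - X 2 * c ∧ w₁₂ = X 0 * a + X 3 * d ∧ w₁₃ = X 0 * b - X 2 * d ∧
      w₂₃ = X 0 * c + X 1 * d := by
  obtain ⟨b, c, d, e1, e2, e3⟩ := koszul_exact_one_of_three (v₀ := w₀₃) (v₁ := w₁₃) (v₂ := w₂₃)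
    (by linear_combination -h₃)
  obtain ⟨a, e4, e5⟩ := koszul_exact_one_of_two (v₀ := w₀₂ + X 3 * c) (v₁ := w₁₂ + X 3 * d)
    (by linear_combination -h₂ + X 3 * e3)
  have e6 : X 0 * (w₀₁ - X 2 * a + X 3 * b) = 0 := by
    linear_combination -h₁ + X 2 * e5 + X 3 * e2
  have e7 : w₀₁ - X 2 * a + X 3 * b = 0 := by
    rcases mul_eq_zero.mp e6 with h | h
    · exact absurd h (X_ne_zero _)
    · exact h
  exact ⟨a, -b, -c, -d, by linear_combination e7, by linear_combination e4,
    by linear_combination e1, by linear_combination e5, by linear_combination e2,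
    by linear_combination e3⟩

/-- The first Koszul cohomology of `R ⧸ I` vanishes if `(x, y, z, w)` contains a regular sequence
of length two. -/
theorem exists_sub_X_mul_mem {I : Ideal Poly} {r₁ r₂ : Poly} (m₁ : r₁ ∈ irrelevantIdeal)
    (m₂ : r₂ ∈ irrelevantIdeal) (h₁ : ∀ a, r₁ * a ∈ I → a ∈ I)
    (h₂ : ∀ a b, r₂ * a - r₁ * b ∈ I → ∃ c, a - r₁ * c ∈ I)
    (a : Fin 4 → Poly) (ha : ∀ i j, X i * a j - X j * a i ∈ I) :
    ∃ s, ∀ i, a i - X i * s ∈ I := by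
  obtain ⟨c, hc⟩ := Ideal.mem_span_range_iff_exists_fun.mp m₁
  obtain ⟨e, he⟩ := Ideal.mem_span_range_iff_exists_fun.mp m₂
  have k1 : r₂ * ∑ i, c i * a i - r₁ * ∑ i, e i * a i ∈ I := by
    rw [← hc, ← he, Finset.sum_mul_sum, Finset.sum_mul_sum, Finset.sum_comm,
      ← Finset.sum_sub_distrib]
    refine I.sum_mem fun i _ => ?_
    rw [← Finset.sum_sub_distrib]
    refine I.sum_mem fun j _ => ?_
    convert I.mul_mem_left (c i * e j) (ha j i) using 1
    ring
  obtain ⟨s, hs⟩ := h₂ _ _ k1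
  refine ⟨s, fun j => h₁ _ ?_⟩
  have k2 : r₁ * a j - X j * ∑ i, c i * a i ∈ I := by
    rw [← hc, Finset.sum_mul, Finset.mul_sum, ← Finset.sum_sub_distrib]
    refine I.sum_mem fun i _ => ?_
    convert I.mul_mem_left (c i) (ha i j) using 1
    ring
  convert I.add_mem k2 (I.mul_mem_left (X j) hs) using 1
  ring

/-- The first Koszul homology of the first syzygies of `I` vanishes if the first Koszul cohomology
of `R ⧸ I`, that is, its third Koszul homology, does. The hypothesis `hI` is applied to the
coefficients of a three-form, whose signs come from the duality between one-forms and
three-forms. As `φ` has values in a domain, `φ v₀ = 0` follows from the other relations. -/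
theorem koszul_exact_one_of_ker {ι : Type*} {I : Ideal Poly}
    (hI : ∀ a : Fin 4 → Poly, (∀ i j, X i * a j - X j * a i ∈ I) → ∃ s, ∀ i, a i - X i * s ∈ I)
    (φ : (ι → Poly) →ₗ[Poly] Poly) (hφ : LinearMap.range φ = I) {v₀ v₁ v₂ v₃ : ι → Poly}
    (h₁ : φ v₁ = 0) (h₂ : φ v₂ = 0) (h₃ : φ v₃ = 0)
    (h : (X 0 : Poly) • v₀ + (X 1 : Poly) • v₁ + (X 2 : Poly) • v₂ + (X 3 : Poly) • v₃ = 0) :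
    ∃ u₀₁ ∈ LinearMap.ker φ, ∃ u₀₂ ∈ LinearMap.ker φ, ∃ u₀₃ ∈ LinearMap.ker φ,
    ∃ u₁₂ ∈ LinearMap.ker φ, ∃ u₁₃ ∈ LinearMap.ker φ, ∃ u₂₃ ∈ LinearMap.ker φ,
      v₀ = (X 1 : Poly) • u₀₁ + (X 2 : Poly) • u₀₂ + (X 3 : Poly) • u₀₃ ∧
      v₁ = -((X 0 : Poly) • u₀₁) + (X 2 : Poly) • u₁₂ + (X 3 : Poly) • u₁₃ ∧
      v₂ = -((X 0 : Poly) • u₀₂) - (X 1 : Poly) • u₁₂ + (X 3 : Poly) • u₂₃ ∧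
      v₃ = -((X 0 : Poly) • u₀₃) - (X 1 : Poly) • u₁₃ - (X 2 : Poly) • u₂₃ := by
  have hc : ∀ i, ∃ u₀₁ u₀₂ u₀₃ u₁₂ u₁₃ u₂₃ : Poly, v₀ i = X 1 * u₀₁ + X 2 * u₀₂ + X 3 * u₀₃ ∧
      v₁ i = -(X 0 * u₀₁) + X 2 * u₁₂ + X 3 * u₁₃ ∧
      v₂ i = -(X 0 * u₀₂) - X 1 * u₁₂ + X 3 * u₂₃ ∧
      v₃ i = -(X 0 * u₀₃) - X 1 * u₁₃ - X 2 * u₂₃ := fun i =>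
    koszul_exact_one (by simpa using congrFun h i)
  choose u₀₁ u₀₂ u₀₃ u₁₂ u₁₃ u₂₃ e₀ e₁ e₂ e₃ using hc
  have f₀ : v₀ = (X 1 : Poly) • u₀₁ + (X 2 : Poly) • u₀₂ + (X 3 : Poly) • u₀₃ := funext e₀
  have f₁ : v₁ = -((X 0 : Poly) • u₀₁) + (X 2 : Poly) • u₁₂ + (X 3 : Poly) • u₁₃ := funext e₁
  have f₂ : v₂ = -((X 0 : Poly) • u₀₂) - (X 1 : Poly) • u₁₂ + (X 3 : Poly) • u₂₃ := funext e₂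
  have f₃ : v₃ = -((X 0 : Poly) • u₀₃) - (X 1 : Poly) • u₁₃ - (X 2 : Poly) • u₂₃ := funext e₃
  rw [f₁] at h₁; rw [f₂] at h₂; rw [f₃] at h₃
  simp only [map_add, map_sub, map_neg, map_smul, smul_eq_mul] at h₁ h₂ h₃
  obtain ⟨a, b, c, d, g₀₁, g₀₂, g₀₃, g₁₂, g₁₃, g₂₃⟩ := koszul_exact_two h₁ h₂ h₃
  have hmem : ∀ x, φ x ∈ I := fun x => hφ ▸ LinearMap.mem_range_self φ x
  have m₀₁ := hmem u₀₁
  have m₀₂ := hmem u₀₂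
  have m₀₃ := hmem u₀₃
  have m₁₂ := hmem u₁₂
  have m₁₃ := hmem u₁₃
  have m₂₃ := hmem u₂₃
  rw [g₀₁] at m₀₁; rw [g₀₂] at m₀₂; rw [g₀₃] at m₀₃
  rw [g₁₂] at m₁₂; rw [g₁₃] at m₁₃; rw [g₂₃] at m₂₃
  obtain ⟨s, hs⟩ := hI ![-d, c, -b, a] (by
    have key : ∀ i j : Fin 4, i < j → X i * ![-d, c, -b, a] j - X j * ![-d, c, -b, a] i ∈ I := by
      intro i j hij
      fin_cases i <;> fin_cases j <;> first | exact absurd hij (by decide) | skip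
      · convert m₂₃ using 1; simp
      · convert I.neg_mem m₁₃ using 1; simp; ring
      · convert m₁₂ using 1; simp
      · convert m₀₃ using 1; simp
      · convert I.neg_mem m₀₂ using 1; simp; ring
      · convert m₀₁ using 1; simp
    intro i j
    rcases lt_trichotomy i j with hij | rfl | hij
    · exact key i j hij
    · simp
    · rw [← neg_sub]
      exact I.neg_mem (key j i hij))
  have ha := hs 3
  have hb := I.neg_mem (hs 2)
  have hcc := hs 1
  have hd := I.neg_mem (hs 0)
  simp only [Matrix.cons_val] at ha hb hcc hd
  rw [← hφ] at ha hb hcc hd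
  obtain ⟨A, hA⟩ := ha
  obtain ⟨B, hB⟩ := hb
  obtain ⟨D, hD⟩ := hcc
  obtain ⟨E, hE⟩ := hd
  refine ⟨u₀₁ - (X 2 : Poly) • A - (X 3 : Poly) • B, ?_,
    u₀₂ + (X 1 : Poly) • A - (X 3 : Poly) • D, ?_,
    u₀₃ + (X 1 : Poly) • B + (X 2 : Poly) • D, ?_,
    u₁₂ - (X 0 : Poly) • A - (X 3 : Poly) • E, ?_,
    u₁₃ - (X 0 : Poly) • B + (X 2 : Poly) • E, ?_,
    u₂₃ - (X 0 : Poly) • D - (X 1 : Poly) • E, ?_, ?_, ?_, ?_, ?_⟩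
  · simp only [LinearMap.mem_ker, map_sub, map_smul, smul_eq_mul, hA, hB]
    linear_combination g₀₁
  · simp only [LinearMap.mem_ker, map_add, map_sub, map_smul, smul_eq_mul, hA, hD]
    linear_combination g₀₂
  · simp only [LinearMap.mem_ker, map_add, map_smul, smul_eq_mul, hB, hD]
    linear_combination g₀₃
  · simp only [LinearMap.mem_ker, map_sub, map_smul, smul_eq_mul, hA, hE]
    linear_combination g₁₂
  · simp only [LinearMap.mem_ker, map_add, map_sub, map_smul, smul_eq_mul, hB, hE]
    linear_combination g₁₃
  · simp only [LinearMap.mem_ker, map_sub, map_smul, smul_eq_mul, hD, hE]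
    linear_combination g₂₃
  · rw [f₀]; module
  · rw [f₁]; module
  · rw [f₂]; module
  · rw [f₃]; module

/-- Minimal generators of the first syzygies are linearly independent: the vanishing of the Koszul
homology shows that the module `N` of relations between them satisfies
`N ≤ (x, y, z, w) • N`. -/
theorem injective_of_ker_le_irrelevantIdeal {ι κ : Type*} {I : Ideal Poly}
    (hI : ∀ a : Fin 4 → Poly, (∀ i j, X i * a j - X j * a i ∈ I) → ∃ s, ∀ i, a i - X i * s ∈ I)
    (φ : (ι → Poly) →ₗ[Poly] Poly) (hφ : LinearMap.range φ = I)
    (ψ : (κ → Poly) →ₗ[Poly] (ι → Poly)) (hψ : LinearMap.range ψ = LinearMap.ker φ)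
    (hmin : ∀ c, ψ c = 0 → ∀ j, c j ∈ irrelevantIdeal) : Function.Injective ψ := by
  have step : ∀ c, ψ c = 0 → ∃ w : Fin 4 → κ → Poly, (∀ i, ψ (w i) = 0) ∧
      c = ∑ i, (X i : Poly) • w i := by
    intro c hc
    have h1 : ∀ j, ∃ w : Fin 4 → Poly, ∑ i, w i * X i = c j := fun j =>
      Ideal.mem_span_range_iff_exists_fun.mp (hmin c hc j)
    choose w hw using h1
    have hcw : c = (X 0 : Poly) • (fun j => w j 0) + (X 1 : Poly) • (fun j => w j 1) +
        (X 2 : Poly) • (fun j => w j 2) + (X 3 : Poly) • (fun j => w j 3) := by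
      funext j
      rw [← hw j]
      simp [Fin.sum_univ_four, mul_comm]
    have hker : ∀ x, φ (ψ x) = 0 := fun x => by
      have : ψ x ∈ LinearMap.ker φ := hψ ▸ LinearMap.mem_range_self ψ x
      exact this
    have hrel := hc
    rw [hcw] at hrel
    simp only [map_add, map_smul] at hrel
    obtain ⟨u₀₁, m₀₁, u₀₂, m₀₂, u₀₃, m₀₃, u₁₂, m₁₂, u₁₃, m₁₃, u₂₃, m₂₃, e₀, e₁, e₂, e₃⟩ :=
      koszul_exact_one_of_ker hI φ hφ (hker _) (hker _) (hker _) hrel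
    rw [← hψ] at m₀₁ m₀₂ m₀₃ m₁₂ m₁₃ m₂₃
    obtain ⟨U₀₁, rfl⟩ := m₀₁
    obtain ⟨U₀₂, rfl⟩ := m₀₂
    obtain ⟨U₀₃, rfl⟩ := m₀₃
    obtain ⟨U₁₂, rfl⟩ := m₁₂
    obtain ⟨U₁₃, rfl⟩ := m₁₃
    obtain ⟨U₂₃, rfl⟩ := m₂₃
    refine ⟨![(fun j => w j 0) - ((X 1 : Poly) • U₀₁ + (X 2 : Poly) • U₀₂ + (X 3 : Poly) • U₀₃),
      (fun j => w j 1) - (-((X 0 : Poly) • U₀₁) + (X 2 : Poly) • U₁₂ + (X 3 : Poly) • U₁₃),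
      (fun j => w j 2) - (-((X 0 : Poly) • U₀₂) - (X 1 : Poly) • U₁₂ + (X 3 : Poly) • U₂₃),
      (fun j => w j 3) - (-((X 0 : Poly) • U₀₃) - (X 1 : Poly) • U₁₃ - (X 2 : Poly) • U₂₃)],
      ?_, ?_⟩
    · intro i
      fin_cases i
      · simp only [Fin.zero_eta, Matrix.cons_val, map_sub, map_add, map_smul]
        rw [e₀, sub_self]
      · simp only [Fin.mk_one, Matrix.cons_val, map_sub, map_add, map_smul, map_neg]
        rw [e₁, sub_self]
      · simp only [Fin.reduceFinMk, Matrix.cons_val, map_sub, map_add, map_smul, map_neg]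
        rw [e₂, sub_self]
      · simp only [Fin.reduceFinMk, Matrix.cons_val, map_sub, map_smul, map_neg]
        rw [e₃, sub_self]
    · rw [Fin.sum_univ_four]
      simp only [Matrix.cons_val]
      conv_lhs => rw [hcw]
      module
  have hpow : ∀ k : ℕ, ∀ c, ψ c = 0 → ∀ j, c j ∈ irrelevantIdeal ^ k := by
    intro k
    induction k with
    | zero => simp
    | succ k ih =>
      intro c hc j
      obtain ⟨w, hw, rfl⟩ := step c hc
      rw [Finset.sum_apply, pow_succ']
      exact Ideal.sum_mem _ fun i _ => Ideal.mul_mem_mul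
        (Ideal.subset_span (Set.mem_range_self i)) (ih (w i) (hw i) j)
  rw [← LinearMap.ker_eq_bot, LinearMap.ker_eq_bot']
  intro c hc
  funext j
  have h1 : c j ∈ ⨅ k, irrelevantIdeal ^ k := Ideal.mem_iInf.mpr fun k => hpow k c hc j
  rwa [Ideal.iInf_pow_eq_bot_of_isDomain _ irrelevantIdeal_isMaximal.ne_top] at h1

end ACMCurve

/-! ### Forms of integer degree and graded syzygies -/

namespace ACMCurve

theorem weight_one_eq_degree (m : Fin 4 →₀ ℕ) :
    Finsupp.weight (1 : Fin 4 → ℕ) m = m.degree := by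
  rw [Finsupp.degree_eq_weight_one]; rfl

theorem isForm_iff {p : Poly} {n : ℤ} :
    IsForm p n ↔ ∀ m, coeff m p ≠ 0 → (m.degree : ℤ) = n := by
  constructor
  · rintro ⟨h1, h2⟩ m hm
    rcases lt_or_ge n 0 with hn | hn
    · simp [h1 hn] at hm
    · have := h2 hm
      rw [weight_one_eq_degree] at this
      omega
  · intro h
    refine ⟨fun hn => ?_, fun m hm => ?_⟩
    · ext m
      by_contra hm
      have := h m hm
      omega
    · have := h m hm
      rw [weight_one_eq_degree]
      omega

theorem IsForm.zero (n : ℤ) : IsForm 0 n := isForm_iff.mpr (by simp)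

theorem IsForm.C (c : ℂ) : IsForm (C c) 0 := by
  classical
  refine isForm_iff.mpr fun m hm => ?_
  rw [coeff_C] at hm
  split_ifs at hm with h
  · simp [← h]
  · exact absurd rfl hm

theorem IsForm.sum {ι : Type*} {s : Finset ι} {p : ι → Poly} {n : ℤ}
    (h : ∀ i ∈ s, IsForm (p i) n) : IsForm (∑ i ∈ s, p i) n := by
  refine isForm_iff.mpr fun m hm => ?_
  rw [coeff_sum] at hm
  obtain ⟨i, hi, h1⟩ := Finset.exists_ne_zero_of_sum_ne_zero hm
  exact isForm_iff.mp (h i hi) m h1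

theorem IsForm.mul {p q : Poly} {m n : ℤ} (hp : IsForm p m) (hq : IsForm q n) :
    IsForm (p * q) (m + n) := by
  classical
  refine isForm_iff.mpr fun k hk => ?_
  rw [coeff_mul] at hk
  obtain ⟨x, hx, h1⟩ := Finset.exists_ne_zero_of_sum_ne_zero hk
  rw [← Finset.HasAntidiagonal.mem_antidiagonal.mp hx, map_add, ← isForm_iff.mp hp
    _ (left_ne_zero_of_mul h1),
    ← isForm_iff.mp hq _ (right_ne_zero_of_mul h1)]
  push_cast
  rfl

theorem IsForm.C_mul {p : Poly} {n : ℤ} (c : ℂ) (hp : IsForm p n) :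
    IsForm (MvPolynomial.C c * p) n := by
  simpa using (IsForm.C c).mul hp

theorem IsForm.prod {ι : Type*} {s : Finset ι} {p : ι → Poly} {n : ι → ℤ}
    (h : ∀ i ∈ s, IsForm (p i) (n i)) : IsForm (∏ i ∈ s, p i) (∑ i ∈ s, n i) := by
  classical
  induction s using Finset.induction_on with
  | empty => simpa using IsForm.C 1
  | insert a s ha ih =>
    rw [Finset.prod_insert ha, Finset.sum_insert ha]
    exact (h a (Finset.mem_insert_self a s)).mul
      (ih fun i hi => h i (Finset.mem_insert_of_mem hi))

theorem IsForm.degree_unique {p : Poly} {m n : ℤ} (hm : IsForm p m) (hn : IsForm p n)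
    (hp : p ≠ 0) : m = n := by
  obtain ⟨k, hk⟩ := ne_zero_iff.mp hp
  rw [← isForm_iff.mp hm k hk, isForm_iff.mp hn k hk]

theorem isForm_natCast_iff {p : Poly} {n : ℕ} : IsForm p n ↔ p.IsHomogeneous n :=
  ⟨fun h => by simpa using h.2, fun h => ⟨fun h0 => by omega, by simpa using h⟩⟩

/-- A form without constant term has positive degree. -/
theorem IsForm.eq_zero_of_nonpos {p : Poly} {n : ℤ} (hp : IsForm p n)
    (hmem : p ∈ irrelevantIdeal) (hn : n ≤ 0) : p = 0 := by
  by_contra h0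
  obtain ⟨k, hk⟩ := ne_zero_iff.mp h0
  have h1 := isForm_iff.mp hp k hk
  have h2 : k.degree = 0 := by omega
  rw [Finsupp.degree_eq_zero_iff] at h2
  rw [h2] at hk
  exact hk (mem_irrelevantIdeal_iff.mp hmem)

/-- The homogeneous component of integer degree `n`; it is `0` if `n` is negative. -/
noncomputable def formComponent (n : ℤ) : Poly →ₗ[ℂ] Poly :=
  if 0 ≤ n then homogeneousComponent n.toNat else 0

theorem coeff_formComponent (n : ℤ) (p : Poly) (m : Fin 4 →₀ ℕ) :
    coeff m (formComponent n p) = if (m.degree : ℤ) = n then coeff m p else 0 := by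
  unfold formComponent
  split_ifs with h1 h2 h2
  · rw [coeff_homogeneousComponent, if_pos (by omega)]
  · rw [coeff_homogeneousComponent, if_neg (by omega)]
  · omega
  · simp

theorem isForm_formComponent (n : ℤ) (p : Poly) : IsForm (formComponent n p) n := by
  refine isForm_iff.mpr fun m hm => ?_
  rw [coeff_formComponent] at hm
  by_contra h
  exact hm (if_neg h)

theorem formComponent_of_isForm {p : Poly} {n : ℤ} (hp : IsForm p n) :
    formComponent n p = p := by
  ext m
  rw [coeff_formComponent]
  split_ifs with h
  · rfl
  · by_contra h1
    exact h (isForm_iff.mp hp m (Ne.symm h1))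

theorem formComponent_zero_eq (p : Poly) : formComponent 0 p = C (coeff 0 p) := by
  simp [formComponent, homogeneousComponent_zero]

theorem formComponent_mul_of_isForm {p : Poly} {n : ℤ} (hp : IsForm p n) (k : ℤ) (c : Poly) :
    formComponent k (c * p) = formComponent (k - n) c * p := by
  classical
  ext m
  rw [coeff_formComponent, coeff_mul, coeff_mul, Finset.ite_sum_zero]
  refine Finset.sum_congr rfl fun x hx => ?_
  rw [coeff_formComponent]
  by_cases h0 : coeff x.2 p = 0
  · simp [h0]
  · have h1 := isForm_iff.mp hp _ h0
    have h2 : (m.degree : ℤ) = x.1.degree + x.2.degree := by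
      rw [← Finset.HasAntidiagonal.mem_antidiagonal.mp hx, map_add]; push_cast; rfl
    by_cases h3 : (m.degree : ℤ) = k
    · rw [if_pos h3, if_pos (by omega)]
    · rw [if_neg h3, if_neg (by omega), zero_mul]

theorem sum_formComponent {N : Finset ℤ} (p : Poly) (a : ℤ)
    (hN : ∀ m ∈ p.support, (m.degree : ℤ) + a ∈ N) :
    ∑ n ∈ N, formComponent (n - a) p = p := by
  ext m
  rw [coeff_sum]
  simp only [coeff_formComponent]
  by_cases hm : coeff m p = 0
  · simp [hm]
  · rw [Finset.sum_eq_single ((m.degree : ℤ) + a)]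
    · simp
    · intro n _ hn
      exact if_neg (by omega)
    · intro h
      exact absurd (hN m (mem_support_iff.mpr hm)) h

/-- A finitely generated span of a set `H` is generated by a finite irredundant subset of `H`. -/
theorem exists_irredundant_finset {R P : Type*} [Ring R] [AddCommGroup P] [Module R P]
    [DecidableEq P] {H : Set P} (hH : (Submodule.span R H).FG) :
    ∃ S : Finset P, (S : Set P) ⊆ H ∧ Submodule.span R (S : Set P) = Submodule.span R H ∧
      ∀ s ∈ S, s ∉ Submodule.span R ((S.erase s : Finset P) : Set P) := by
  obtain ⟨S₀, h1, h2⟩ := Submodule.fg_span_iff_fg_span_finset_subset H |>.mp hH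
  obtain ⟨S, hS, hmin⟩ := (wellFounded_lt (α := Finset P)).has_min
    {S | (S : Set P) ⊆ H ∧ Submodule.span R (S : Set P) = Submodule.span R H} ⟨S₀, h1, h2.symm⟩
  refine ⟨S, hS.1, hS.2, fun s hs hmem => ?_⟩
  refine hmin (S.erase s) ⟨fun x hx => hS.1 (Finset.mem_of_mem_erase hx), ?_⟩
    (Finset.erase_ssubset hs)
  rw [← hS.2]
  conv_rhs => rw [← Finset.insert_erase hs, Finset.coe_insert, Submodule.span_insert_eq_span hmem]

/-- Homogeneous minimal generators satisfy no relation with a constant term in a coefficient. Here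
`comp n` takes the component of degree `n` in the graded module `P`, and `β j` is the degree of the
generator `e j`. -/
theorem mem_irrelevantIdeal_of_relation {P J : Type*} [AddCommGroup P] [Module Poly P] [Fintype J]
    (comp : ℤ → P →+ P) (e : J → P) (β : J → ℤ)
    (hcomp : ∀ n (c : Poly) j, comp n (c • e j) = formComponent (n - β j) c • e j)
    (hirr : ∀ j, e j ∉ Submodule.span Poly (e '' {j}ᶜ)) {c : J → Poly}
    (hc : ∑ j, c j • e j = 0) (j : J) : c j ∈ irrelevantIdeal := by
  classical
  rw [mem_irrelevantIdeal_iff]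
  by_contra h0
  have h1 := congrArg (comp (β j)) hc
  rw [map_sum, map_zero, ← Finset.add_sum_erase _ _ (Finset.mem_univ j), hcomp, sub_self,
    formComponent_zero_eq] at h1
  have h2 : (C (coeff 0 (c j)) : Poly) • e j ∈ Submodule.span Poly (e '' {j}ᶜ) := by
    rw [eq_neg_of_add_eq_zero_left h1]
    refine neg_mem (Submodule.sum_mem _ fun k hk => ?_)
    rw [hcomp]
    exact Submodule.smul_mem _ _ (Submodule.subset_span
      ⟨k, by simpa using Finset.ne_of_mem_erase hk, rfl⟩)
  have h3 := Submodule.smul_mem _ (C (coeff 0 (c j))⁻¹ : Poly) h2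
  rw [smul_smul, ← C_mul, inv_mul_cancel₀ h0, C_1, one_smul] at h3
  exact hirr j h3

theorem not_mem_span_image_compl {R P J : Type*} [Ring R] [AddCommGroup P] [Module R P]
    [DecidableEq P] {S : Finset P}
    (hS : ∀ s ∈ S, s ∉ Submodule.span R ((S.erase s : Finset P) : Set P)) {e : J → P}
    (he : Function.Injective e) (heS : ∀ j, e j ∈ S) (j : J) :
    e j ∉ Submodule.span R (e '' {j}ᶜ) := by
  refine fun h => hS _ (heS j) (Submodule.span_mono ?_ h)
  rintro _ ⟨k, hk, rfl⟩
  exact Finset.mem_coe.mpr (Finset.mem_erase.mpr ⟨fun h1 => hk (he h1), heS k⟩)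

theorem exists_monotone_equiv {ι γ : Type*} [Fintype ι] [LinearOrder γ] {n : ℕ}
    (h : Fintype.card ι = n) (g : ι → γ) : ∃ e : Fin n ≃ ι, Monotone (g ∘ e) := by
  let e₀ : Fin n ≃ ι := (Fintype.equivFinOfCardEq h).symm
  exact ⟨(Tuple.sort (g ∘ e₀)).trans e₀, Tuple.monotone_sort (g ∘ e₀)⟩

/-- The component of degree `n` of a vector in the graded module `⨁ i, R(-α i)`. -/
noncomputable def vectorComponent {ι : Type*} (α : ι → ℤ) (n : ℤ) :
    (ι → Poly) →+ (ι → Poly) where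
  toFun v i := formComponent (n - α i) (v i)
  map_zero' := by ext1 i; simp
  map_add' v w := by ext1 i; simp

theorem vectorComponent_smul {ι : Type*} {α : ι → ℤ} {v : ι → Poly} {k : ℤ}
    (hv : ∀ i, IsForm (v i) (k - α i)) (n : ℤ) (c : Poly) :
    vectorComponent α n (c • v) = formComponent (n - k) c • v := by
  ext1 i
  change formComponent (n - α i) (c * v i) = formComponent (n - k) c * v i
  rw [formComponent_mul_of_isForm (hv i), sub_sub_sub_cancel_right]

theorem exists_sum_vectorComponent {ι : Type*} [Fintype ι] (α : ι → ℤ) (v : ι → Poly) :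
    ∃ N : Finset ℤ, ∑ n ∈ N, vectorComponent α n v = v := by
  classical
  refine ⟨Finset.univ.biUnion fun i => (v i).support.image fun m => (m.degree : ℤ) + α i, ?_⟩
  ext1 i
  rw [Finset.sum_apply]
  exact sum_formComponent (v i) (α i) fun m hm => Finset.mem_biUnion.mpr
    ⟨i, Finset.mem_univ i, Finset.mem_image.mpr ⟨m, hm, rfl⟩⟩

/-- The graded Auslander–Buchsbaum formula for curves: minimal generators of the ideal of an ACM
curve have a free module of syzygies. -/
theorem Curve.IsACM.exists_resolution {C : Curve} (hC : C.IsACM) {ι : Type} [Fintype ι]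
    {f : ι → Poly} {α : ι → ℤ} (hf : ∀ i, IsForm (f i) (α i))
    (hspan : Ideal.span (Set.range f) = C.ideal)
    (hirr : ∀ i, f i ∉ Submodule.span Poly (f '' {i}ᶜ)) :
    ∃ (m : ℕ) (β : Fin m → ℤ) (M : Matrix ι (Fin m) Poly),
      (∀ i j, IsForm (M i j) (β j - α i)) ∧ (∀ i j, M i j ∈ irrelevantIdeal) ∧
      Function.Injective M.mulVecLin ∧
      Function.Exact M.mulVecLin (Fintype.linearCombination Poly f) ∧
      LinearMap.range (Fintype.linearCombination Poly f) = C.ideal := by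
  classical
  set φ := Fintype.linearCombination Poly f with hφ
  have hrange : LinearMap.range φ = C.ideal := by
    rw [hφ, Fintype.range_linearCombination, ← hspan]
  let H : Set (ι → Poly) := {v | φ v = 0 ∧ ∃ n : ℤ, ∀ i, IsForm (v i) (n - α i)}
  have hHspan : Submodule.span Poly H = LinearMap.ker φ := by
    refine le_antisymm (Submodule.span_le.mpr fun v hv => hv.1) fun v hv => ?_
    obtain ⟨N, hN⟩ := exists_sum_vectorComponent α v
    rw [← hN]
    refine Submodule.sum_mem _ fun n _ => Submodule.subset_span ⟨?_, n, fun i =>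
      isForm_formComponent _ _⟩
    have h1 := congrArg (formComponent n) (LinearMap.mem_ker.mp hv)
    rw [hφ, Fintype.linearCombination_apply, map_sum, map_zero] at h1
    rw [hφ, Fintype.linearCombination_apply, ← h1]
    exact Finset.sum_congr rfl fun i _ => (formComponent_mul_of_isForm (hf i) n (v i)).symm
  obtain ⟨S, hSH, hS, hSirr⟩ := exists_irredundant_finset (R := Poly) (H := H)
    (IsNoetherian.noetherian _)
  let e : Fin S.card → ι → Poly := fun j => (S.equivFin.symm j : ι → Poly)
  have heinj : Function.Injective e := Subtype.val_injective.comp S.equivFin.symm.injective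
  have heS : ∀ j, e j ∈ S := fun j => (S.equivFin.symm j).2
  have herange : Set.range e = S := by
    ext x
    exact ⟨fun ⟨j, hj⟩ => hj ▸ heS j, fun hx => ⟨S.equivFin ⟨x, hx⟩, by simp [e]⟩⟩
  choose β hβ using fun j => (hSH (heS j)).2
  let M : Matrix ι (Fin S.card) Poly := Matrix.of fun i j => e j i
  have hM : ∀ c, M.mulVecLin c = ∑ j, c j • e j := by
    intro c
    ext1 i
    rw [Matrix.mulVecLin_apply, Matrix.mulVec, dotProduct, Finset.sum_apply]
    exact Finset.sum_congr rfl fun j _ => mul_comm _ _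
  have hMrange : LinearMap.range M.mulVecLin = LinearMap.ker φ := by
    have h1 : M.mulVecLin = Fintype.linearCombination Poly e := by
      refine LinearMap.ext fun c => ?_
      rw [hM, Fintype.linearCombination_apply]
    rw [h1, Fintype.range_linearCombination, herange, hS, hHspan]
  have hker : ∀ j, φ (e j) = 0 := fun j => (hSH (heS j)).1
  obtain ⟨r₁, m₁, r₂, m₂, g₁, g₂⟩ := hC.exists_regular_pair
  refine ⟨S.card, β, M, fun i j => hβ j i, fun i j => ?_, ?_, ?_, hrange⟩
  · refine mem_irrelevantIdeal_of_relation (fun n => (formComponent n).toAddMonoidHom) f α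
      (fun n c j => formComponent_mul_of_isForm (hf j) n c) hirr (c := e j) ?_ i
    rw [← Fintype.linearCombination_apply]
    exact hker j
  · refine injective_of_ker_le_irrelevantIdeal
      (exists_sub_X_mul_mem m₁ m₂ g₁ g₂) φ hrange _ hMrange fun c hc j => ?_
    rw [hM] at hc
    exact mem_irrelevantIdeal_of_relation (vectorComponent α) e β
      (fun n c j => vectorComponent_smul (hβ j) n c)
      (not_mem_span_image_compl hSirr heinj heS) hc j
  · exact LinearMap.exact_iff.mpr hMrange.symm

end ACMCurve

/-! ### The Hilbert–Burch theorem -/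

namespace ACMCurve

/-- A family without common prime factor is as good as `1` for testing divisibility. -/
theorem dvd_of_forall_dvd_mul {R ι : Type*} [CommRing R] [IsDomain R]
    [UniqueFactorizationMonoid R] {f : ι → R} (hf0 : ∃ i, f i ≠ 0)
    (hf : ∀ p, Prime p → ∃ i, ¬ p ∣ f i) (a : R) : ∀ x, (∀ i, a ∣ f i * x) → a ∣ x := by
  induction a using UniqueFactorizationMonoid.induction_on_prime with
  | h₁ =>
    intro x hx
    obtain ⟨i, hi⟩ := hf0
    simpa [hi] using hx i
  | h₂ a ha => exact fun x _ => ha.dvd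
  | h₃ a p ha hp ih =>
    intro x hx
    obtain ⟨y, rfl⟩ := ih x fun i => (Dvd.intro_left p rfl).trans (hx i)
    rw [mul_comm p a]
    refine mul_dvd_mul_left a ?_
    obtain ⟨i, hi⟩ := hf p hp
    have h1 := hx i
    rw [mul_comm p a, mul_left_comm, mul_dvd_mul_iff_left ha] at h1
    exact (hp.dvd_or_dvd h1).resolve_left hi

/-- The square matrix with the columns of `M` and one more column `c`. -/
abbrev adjoinColumn {R ι κ : Type*} (M : Matrix ι κ R) (c : ι → R) : Matrix ι (κ ⊕ Unit) R :=
  Matrix.fromCols M (Matrix.replicateCol Unit c)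

theorem exists_mulVec_eq_zero_of_det_adjoinColumn {B κ : Type*} [CommRing B] [IsDomain B]
    [Fintype κ] [DecidableEq κ] (M : Matrix (κ ⊕ Unit) κ B)
    (h : ∀ c, (adjoinColumn M c).det = 0) : ∃ v, v ≠ 0 ∧ M.mulVec v = 0 := by
  by_contra! hM
  have h1 : ∀ i : κ ⊕ Unit, ∃ (v : κ → B) (a : B), a ≠ 0 ∧
      M.mulVec v = a • Pi.single i 1 := by
    intro i
    obtain ⟨w, hw, hw0⟩ := Matrix.exists_mulVec_eq_zero_iff.mpr (h (Pi.single i 1))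
    have h2 : M.mulVec (w ∘ Sum.inl) = (-w (Sum.inr ())) • Pi.single i 1 := by
      rw [← Sum.elim_comp_inl_inr w, Matrix.fromCols_mulVec_sumElim] at hw0
      rw [eq_neg_of_add_eq_zero_left hw0]
      ext j
      simp [Matrix.mulVec, dotProduct, mul_comm]
    refine ⟨w ∘ Sum.inl, -w (Sum.inr ()), fun ha => ?_, h2⟩
    rw [ha, zero_smul] at h2
    refine hM _ (fun h3 => hw ?_) h2
    ext j
    rcases j with j | j
    · exact congrFun h3 j
    · exact neg_eq_zero.mp ha
  choose v a ha hva using h1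
  let V : Matrix κ (κ ⊕ Unit) B := Matrix.of fun k i => v i k
  have h3 : ¬ Function.Injective V.mulVecLin := fun hinj => by
    have := card_le_of_injective B V.mulVecLin hinj
    simp at this
  rw [← LinearMap.ker_eq_bot, Submodule.eq_bot_iff] at h3
  push Not at h3
  obtain ⟨w, hw, hw0⟩ := h3
  apply hw0
  have h4 : M.mulVec (V.mulVec w) = fun i => a i * w i := by
    have h5 : V.mulVec w = ∑ i, w i • v i := by
      ext k
      simp [V, Matrix.mulVec, dotProduct, mul_comm]
    rw [h5, ← Matrix.mulVecLin_apply, map_sum]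
    simp only [map_smul, Matrix.mulVecLin_apply, hva]
    ext j
    simp [Finset.sum_apply, Pi.single_apply, mul_comm]
  have h6 : V.mulVec w = 0 := hw
  rw [h6, Matrix.mulVec_zero] at h4
  ext i
  simpa [ha i] using (congrFun h4 i).symm

/-- **Hilbert–Burch theorem**: if `0 → R^κ → R^(κ + 1) → R` is exact and the image of the right map
`f` has codimension at least two, then `det [M | c] = u * f c` for a unit `u`. Both sides are linear
in `c` and vanish on the image of `M`, so one is a multiple of the other; the factor is a unit,
since `M` keeps its rank modulo every prime element. -/
theorem exists_isUnit_det_adjoinColumn {R κ : Type*} [CommRing R] [IsDomain R]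
    [UniqueFactorizationMonoid R] [Fintype κ] [DecidableEq κ] {f : κ ⊕ Unit → R}
    {M : Matrix (κ ⊕ Unit) κ R} (hf0 : ∃ i, f i ≠ 0) (hf : ∀ p, Prime p → ∃ i, ¬ p ∣ f i)
    (hinj : Function.Injective M.mulVecLin)
    (hex : Function.Exact M.mulVecLin (Fintype.linearCombination R f)) :
    ∃ u, IsUnit u ∧ ∀ c, (adjoinColumn M c).det = u * ∑ i, c i * f i := by
  let D : (κ ⊕ Unit → R) →ₗ[R] R :=
    LinearMap.proj (Sum.inr ()) ∘ₗ Matrix.cramer (adjoinColumn M 0)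
  have hD : ∀ c, D c = (adjoinColumn M c).det := by
    intro c
    change Matrix.cramer (adjoinColumn M 0) c (Sum.inr ()) = _
    rw [Matrix.cramer_apply]
    congr 1
    ext i j
    rcases j with j | j <;> simp
  have hDM : ∀ v, D (M.mulVec v) = 0 := by
    intro v
    rw [hD, ← Matrix.exists_mulVec_eq_zero_iff]
    refine ⟨Sum.elim v (fun _ => -1), fun h => ?_, ?_⟩
    · simpa using congrFun h (Sum.inr ())
    · rw [Matrix.fromCols_mulVec_sumElim]
      ext i
      simp [Matrix.mulVec, dotProduct]
  have hker : ∀ c, ∑ i, c i * f i = 0 → D c = 0 := by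
    intro c hc
    obtain ⟨v, rfl⟩ := (hex c).mp (by simpa [Fintype.linearCombination_apply] using hc)
    exact hDM v
  have hcomm : ∀ i j, f i * D (Pi.single j 1) = f j * D (Pi.single i 1) := by
    intro i j
    have := hker (f i • Pi.single j 1 - f j • Pi.single i 1) (by
      simp only [Pi.sub_apply, Pi.smul_apply, smul_eq_mul, sub_mul, mul_assoc,
        Finset.sum_sub_distrib, ← Finset.mul_sum, Pi.single_apply, ite_mul, one_mul, zero_mul,
        Finset.sum_ite_eq', Finset.mem_univ, if_true]
      ring)
    rwa [map_sub, map_smul, map_smul, sub_eq_zero] at this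
  obtain ⟨i₀, hi₀⟩ := hf0
  obtain ⟨u, hu⟩ := dvd_of_forall_dvd_mul ⟨i₀, hi₀⟩ hf (f i₀) (D (Pi.single i₀ 1))
    fun i => ⟨_, (hcomm i i₀)⟩
  have hDu : ∀ i, D (Pi.single i 1) = u * f i := by
    intro i
    refine mul_left_cancel₀ hi₀ ?_
    rw [hcomm i₀ i, hu]
    ring
  have hfin : ∀ c, (adjoinColumn M c).det = u * ∑ i, c i * f i := by
    intro c
    rw [← hD]
    conv_lhs => rw [pi_eq_sum_univ' c]
    rw [map_sum, Finset.mul_sum]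
    refine Finset.sum_congr rfl fun i _ => ?_
    rw [map_smul, hDu, smul_eq_mul]
    ring
  refine ⟨u, ?_, hfin⟩
  have key : ∀ p, (Ideal.span {p}).IsPrime → ¬ p ∣ u := by
    rintro p hp ⟨q, rfl⟩
    let π := Ideal.Quotient.mk (Ideal.span {p})
    have hπ : ∀ x, π x = 0 ↔ p ∣ x := fun x => by
      rw [Ideal.Quotient.eq_zero_iff_mem, Ideal.mem_span_singleton]
    obtain ⟨v, hv, hv0⟩ := exists_mulVec_eq_zero_of_det_adjoinColumn (M.map π) (by
      intro c
      choose c' hc' using fun i => Ideal.Quotient.mk_surjective (c i)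
      have h1 : adjoinColumn (M.map π) c = (adjoinColumn M c').map π := by
        ext i j
        rcases j with j | j
        · simp
        · simpa using (hc' i).symm
      rw [h1, ← RingHom.mapMatrix_apply, ← RingHom.map_det, hfin, hπ]
      exact (dvd_mul_right p q).mul_right _)
    choose v' hv' using fun i => Ideal.Quotient.mk_surjective (v i)
    have h2 : ∀ i, p ∣ M.mulVec v' i := by
      intro i
      rw [← hπ, RingHom.map_mulVec]
      rw [show π ∘ v' = v from funext hv']
      exact congrFun hv0 i
    choose w hw using h2
    have h3 : M.mulVec v' = p • w := funext hw
    have h4 : ∀ j, p ∣ v' j := by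
      by_cases hp0 : p = 0
      · have h5 : M.mulVecLin v' = M.mulVecLin 0 := by
          rw [map_zero, Matrix.mulVecLin_apply, h3, hp0, zero_smul]
        rw [hinj h5]
        simp
      · have h5 := hex.apply_apply_eq_zero v'
        rw [Matrix.mulVecLin_apply, h3, map_smul, smul_eq_mul] at h5
        obtain ⟨z, hz⟩ := (hex w).mp ((mul_eq_zero.mp h5).resolve_left hp0)
        have h6 : M.mulVecLin v' = M.mulVecLin (p • z) := by
          rw [map_smul, hz, Matrix.mulVecLin_apply, h3]
        rw [hinj h6]
        exact fun j => dvd_mul_right p (z j)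
    apply hv
    ext j
    rw [← hv' j, Pi.zero_apply]
    exact (hπ _).mpr (h4 j)
  by_contra hu
  by_cases hu0 : u = 0
  · refine key 0 ?_ (hu0 ▸ dvd_rfl)
    rw [Ideal.span_singleton_eq_bot.mpr rfl]
    exact Ideal.isPrime_bot
  · obtain ⟨p, hp, hpu⟩ := WfDvdMonoid.exists_irreducible_factor hu hu0
    exact key p ((Ideal.span_singleton_prime hp.ne_zero).mpr hp.prime) hpu

/-- The ranks in a free resolution of length one of a nonzero ideal. -/
theorem card_add_one_eq_of_exact {R ι κ : Type*} [CommRing R] [IsDomain R] [Fintype ι] [Fintype κ]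
    {f : ι → R} {M : Matrix ι κ R} (hf0 : ∃ i, f i ≠ 0) (hinj : Function.Injective M.mulVecLin)
    (hex : Function.Exact M.mulVecLin (Fintype.linearCombination R f)) :
    Fintype.card κ + 1 = Fintype.card ι := by
  classical
  obtain ⟨i₀, hi₀⟩ := hf0
  have hφ : ∀ v, ∑ i, M.mulVecLin v i * f i = 0 := fun v => by
    simpa [Fintype.linearCombination_apply] using hex.apply_apply_eq_zero v
  refine le_antisymm ?_ ?_
  · -- the image of `M` meets the span of the basis vector `i₀` trivially
    let L : (κ ⊕ Unit → R) →ₗ[R] (ι → R) :=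
      M.mulVecLin ∘ₗ LinearMap.funLeft R R Sum.inl +
        LinearMap.single R (fun _ => R) i₀ ∘ₗ LinearMap.proj (Sum.inr ())
    have hL : ∀ c, L c = M.mulVecLin (c ∘ Sum.inl) + Pi.single i₀ (c (Sum.inr ())) :=
      fun c => rfl
    have hinjL : Function.Injective L := by
      rw [← LinearMap.ker_eq_bot, LinearMap.ker_eq_bot']
      intro c hc
      rw [hL] at hc
      have h1 : c (Sum.inr ()) = 0 := by
        have h2 := hφ (c ∘ Sum.inl)
        rw [eq_neg_of_add_eq_zero_left hc] at h2
        simpa [Pi.single_apply, hi₀] using h2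
      rw [h1, Pi.single_zero, add_zero] at hc
      have h3 := hinj (hc.trans (map_zero _).symm)
      funext j
      rcases j with j | j
      · exact congrFun h3 j
      · exact h1
    simpa using card_le_of_injective R L hinjL
  · -- the syzygies `f i₀ • e i - f i • e i₀` have rank `card ι - 1`
    have h1 : ∀ i, ∃ v, M.mulVecLin v = f i₀ • Pi.single i 1 - f i • Pi.single i₀ 1 := by
      intro i
      refine (hex _).mp ?_
      simp [mul_comm]
    choose v hv using h1
    let L : (ι → R) →ₗ[R] (κ ⊕ Unit → R) :=
      LinearMap.pi (Sum.elim (fun k => LinearMap.proj k ∘ₗ Fintype.linearCombination R v)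
        (fun _ => LinearMap.proj i₀))
    have hinjL : Function.Injective L := by
      rw [← LinearMap.ker_eq_bot, LinearMap.ker_eq_bot']
      intro c hc
      have h2 : c i₀ = 0 := congrFun hc (Sum.inr ())
      have h3 : ∑ i, c i • v i = 0 := funext fun k => congrFun hc (Sum.inl k)
      have h4 := congrArg M.mulVecLin h3
      rw [map_sum, map_zero] at h4
      simp only [map_smul, hv] at h4
      funext i
      by_cases hi : i = i₀
      · rw [hi, h2, Pi.zero_apply]
      · have h5 := congrFun h4 i
        simp [Finset.sum_apply, Pi.single_apply, hi, hi₀] at h5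
        exact h5
    simpa using card_le_of_injective R L hinjL

end ACMCurve

/-! ### Determinants of graded matrices and types of a surface -/

namespace ACMCurve

theorem isForm_det {n : Type*} [Fintype n] [DecidableEq n] {S : Matrix n n Poly} {a b : n → ℤ}
    (hS : ∀ i j, IsForm (S i j) (b j - a i)) : IsForm S.det (∑ i, (b i - a i)) := by
  rw [Matrix.det_apply']
  refine IsForm.sum fun σ _ => ?_
  have h1 := IsForm.prod (s := Finset.univ) fun i _ => hS (σ i) i
  rw [Finset.sum_sub_distrib, Equiv.sum_comp σ a, ← Finset.sum_sub_distrib] at h1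
  simpa using h1.C_mul ((Equiv.Perm.sign σ : ℤ) : ℂ)

/-- If `b i ≤ a i`, then a graded matrix without units has a block of zeros, in the rows from `i` on
and the columns up to `i`, that is too large for the determinant not to vanish. -/
theorem lt_of_det_ne_zero {n : ℕ} {S : Matrix (Fin n) (Fin n) Poly} {a b : Fin n → ℤ}
    (ha : Monotone a) (hb : Monotone b) (hS : ∀ i j, IsForm (S i j) (b j - a i))
    (hmem : ∀ i j, S i j ∈ irrelevantIdeal) (hdet : S.det ≠ 0) (i : Fin n) : a i < b i := by
  by_contra! hi
  refine hdet ?_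
  rw [Matrix.det_apply']
  refine Finset.sum_eq_zero fun σ _ => ?_
  have h1 : ∃ j ≤ i, i ≤ σ j := by
    by_contra! h
    have h2 := Finset.card_le_card_of_injOn σ (s := Finset.Iic i) (t := Finset.Iio i)
      (fun j hj => by simpa using h j (by simpa using hj)) σ.injective.injOn
    simp at h2
  obtain ⟨j, hj, hij⟩ := h1
  have h3 : S (σ j) j = 0 :=
    (hS (σ j) j).eq_zero_of_nonpos (hmem _ _) (by linarith [ha hij, hb hj])
  rw [Finset.prod_eq_zero (f := fun i => S (σ i) i) (Finset.mem_univ j) h3, mul_zero]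

/-- A graded matrix without units whose determinant is `F` up to a constant shows that `V(F)` is
weak determinantal. -/
theorem isWeakDeterminantalOfType_of_det {n : ℕ} (hn : 2 ≤ n) {a b : Fin n → ℤ}
    (ha : Monotone a) (hb : Monotone b) {S : Matrix (Fin n) (Fin n) Poly}
    (hS : ∀ i j, IsForm (S i j) (b j - a i)) (hmem : ∀ i j, S i j ∈ irrelevantIdeal)
    {F u : Poly} {d : ℕ} (hF : F.IsHomogeneous d) (hF0 : F ≠ 0) (hu : IsUnit u)
    (hdet : S.det = u * F) :
    ∃ h : ∀ i, a i < b i, IsWeakDeterminantalOfType F d ⟨n, hn, a, b, ha, hb, h⟩ := by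
  have hdet0 : S.det ≠ 0 := by
    rw [hdet]; exact mul_ne_zero hu.ne_zero hF0
  obtain ⟨c, hc, rfl⟩ := MvPolynomial.isUnit_iff_eq_C_of_isReduced.mp hu
  have hc0 : c ≠ 0 := hc.ne_zero
  -- the constant is removed by scaling all entries
  obtain ⟨z, hz⟩ := IsAlgClosed.exists_pow_nat_eq c⁻¹ (n := n) (by omega)
  refine ⟨lt_of_det_ne_zero ha hb hS hmem hdet0, ?_, (C z : Poly) • S,
    fun i j => (hS i j).C_mul z, fun i j hij => ?_, ?_⟩
  · have h1 := isForm_det hS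
    rw [hdet] at h1
    exact h1.degree_unique ((isForm_natCast_iff.mpr hF).C_mul c) (hdet ▸ hdet0)
  · have h2 : S i j = 0 := (hS i j).eq_zero_of_nonpos (hmem i j) (by
      have : b j ≤ a i := hij
      linarith)
    rw [Matrix.smul_apply, h2, smul_zero]
  · rw [Matrix.det_smul, Fintype.card_fin, hdet, ← C_pow, hz, ← mul_assoc, ← C_mul,
      inv_mul_cancel₀ hc0, C_1, one_mul]

/-! ### Minimal generators -/

theorem isForm_totalDegree {p : Poly} {n : ℕ} (hp : p.IsHomogeneous n) :
    IsForm p p.totalDegree := by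
  by_cases h : p = 0
  · rw [h]; exact IsForm.zero _
  · rw [hp.totalDegree h]; exact isForm_natCast_iff.mpr hp

theorem IsMinimalGenerator.exists_irredundant {F : Poly} {I : Ideal Poly} [DecidableEq Poly]
    (h : IsMinimalGenerator F I) :
    ∃ S : Finset Poly, F ∈ S ∧ (∀ g ∈ S, ∃ n : ℕ, g.IsHomogeneous n) ∧
      Submodule.span Poly (S : Set Poly) = I ∧
      ∀ s ∈ S, s ∉ Submodule.span Poly ((S.erase s : Finset Poly) : Set Poly) := by
  obtain ⟨S, h1, h2, h3, h4⟩ := h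
  refine ⟨S, h1, h2, h3, fun s hs hmem => h4 (S.erase s) (Finset.erase_ssubset hs) ?_⟩
  rw [← h3]
  conv_rhs => rw [← Finset.insert_erase hs, Finset.coe_insert]
  exact (Submodule.span_insert_eq_span hmem).symm

theorem Curve.exists_irredundant (C : Curve) [DecidableEq Poly] :
    ∃ S : Finset Poly, (∀ g ∈ S, ∃ n : ℕ, g.IsHomogeneous n) ∧
      Submodule.span Poly (S : Set Poly) = C.ideal ∧
      ∀ s ∈ S, s ∉ Submodule.span Poly ((S.erase s : Finset Poly) : Set Poly) := by
  obtain ⟨S, h1, h2, h3⟩ := exists_irredundant_finset (R := Poly)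
    (H := {g | g ∈ C.ideal ∧ ∃ n : ℕ, g.IsHomogeneous n}) (IsNoetherian.noetherian _)
  refine ⟨S, fun g hg => (h1 hg).2, ?_, h3⟩
  rw [h2]
  refine le_antisymm (Submodule.span_le.mpr fun g hg => hg.1) fun g hg => ?_
  rw [← sum_homogeneousComponent g]
  exact Submodule.sum_mem _ fun n _ => Submodule.subset_span
    ⟨C.homogeneous g hg n, n, homogeneousComponent_isHomogeneous n g⟩

theorem Curve.isCompleteIntersection_of_card_le_two {C : Curve} {S : Finset Poly}
    (hS : ∀ g ∈ S, ∃ n : ℕ, g.IsHomogeneous n)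
    (hspan : Submodule.span Poly (S : Set Poly) = C.ideal) (hcard : S.card ≤ 2) :
    C.IsCompleteIntersection := by
  classical
  have h : S.card = 0 ∨ S.card = 1 ∨ S.card = 2 := by omega
  rcases h with h | h | h
  · rw [Finset.card_eq_zero] at h
    refine ⟨0, 0, 0, 0, isHomogeneous_zero _ _ _, isHomogeneous_zero _ _ _, ?_⟩
    rw [← hspan, h]
    simp
  · obtain ⟨f, rfl⟩ := Finset.card_eq_one.mp h
    obtain ⟨n, hn⟩ := hS f (by simp)
    refine ⟨f, f, n, n, hn, hn, ?_⟩
    rw [← hspan]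
    simp
  · obtain ⟨f, g, -, rfl⟩ := Finset.card_eq_two.mp h
    obtain ⟨n, hn⟩ := hS f (by simp)
    obtain ⟨m, hm⟩ := hS g (by simp)
    refine ⟨f, g, n, m, hn, hm, ?_⟩
    rw [← hspan]
    simp

/-- The exchange property of minimal generators: a form `F` of the ideal that is not a minimal
generator is a combination of minimal generators with coefficients without constant terms. If the
coefficient of `f i₀` were a constant, `F` could replace `f i₀`. -/
theorem mem_irrelevantIdeal_of_not_isMinimalGenerator {ι : Type*} [Fintype ι] {I : Ideal Poly}
    {f : ι → Poly} {α : ι → ℤ} (hf : ∀ i, IsForm (f i) (α i))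
    (hhom : ∀ i, ∃ n : ℕ, (f i).IsHomogeneous n)
    (hspan : Submodule.span Poly (Set.range f) = I)
    (hirr : ∀ i, f i ∉ Submodule.span Poly (f '' {i}ᶜ)) {F : Poly} {d : ℕ}
    (hF : F.IsHomogeneous d) (hmin : ¬ IsMinimalGenerator F I) {c : ι → Poly}
    (hc : ∀ i, IsForm (c i) (d - α i)) (hcF : ∑ i, c i * f i = F) (i₀ : ι) :
    c i₀ ∈ irrelevantIdeal := by
  classical
  by_contra h0
  rw [mem_irrelevantIdeal_iff] at h0
  have hrel : ∀ {g : ι → Poly}, ∑ i, g i * f i = 0 → ∀ i, g i ∈ irrelevantIdeal := fun hg i =>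
    mem_irrelevantIdeal_of_relation (fun n => (formComponent n).toAddMonoidHom) f α
      (fun n c j => formComponent_mul_of_isForm (hf j) n c) hirr hg i
  have hconst : c i₀ = C (coeff 0 (c i₀)) := by
    have h1 := isForm_iff.mp (hc i₀) 0 h0
    have h2 := formComponent_of_isForm (hc i₀)
    rw [← h1] at h2
    rw [← formComponent_zero_eq]
    simpa using h2.symm
  have hFspan : F - c i₀ * f i₀ ∈ Submodule.span Poly (f '' {i₀}ᶜ) := by
    rw [← hcF, ← Finset.add_sum_erase _ _ (Finset.mem_univ i₀), add_sub_cancel_left]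
    exact Submodule.sum_mem _ fun k hk => Submodule.smul_mem _ _ (Submodule.subset_span
      ⟨k, by simpa using Finset.ne_of_mem_erase hk, rfl⟩)
  have hf₀ : ∀ N : Submodule Poly Poly, F ∈ N → f '' {i₀}ᶜ ⊆ N → f i₀ ∈ N := by
    intro N h1 h2
    have h3 := N.smul_mem (C (coeff 0 (c i₀))⁻¹) (N.sub_mem h1 (Submodule.span_le.mpr h2 hFspan))
    rw [sub_sub_cancel, hconst, smul_eq_mul, ← mul_assoc, ← C_mul] at h3
    simpa [h0] using h3
  refine hmin ⟨insert F ((Finset.univ.erase i₀).image f), Finset.mem_insert_self _ _, ?_, ?_, ?_⟩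
  · intro g hg
    rcases Finset.mem_insert.mp hg with rfl | hg
    · exact ⟨d, hF⟩
    · obtain ⟨i, -, rfl⟩ := Finset.mem_image.mp hg
      exact hhom i
  · have hFI : F ∈ I := by
      rw [← hspan, ← hcF]
      exact Submodule.sum_mem _ fun k _ =>
        Submodule.smul_mem _ _ (Submodule.subset_span (Set.mem_range_self k))
    refine le_antisymm (Ideal.span_le.mpr ?_) ?_
    · intro g hg
      rcases Finset.mem_insert.mp hg with rfl | hg
      · exact hFI
      · obtain ⟨i, -, rfl⟩ := Finset.mem_image.mp hg
        rw [← hspan]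
        exact Submodule.subset_span (Set.mem_range_self i)
    · rw [← hspan, Submodule.span_le]
      have h1 : ∀ i, i ≠ i₀ → f i ∈ Ideal.span
          ((insert F ((Finset.univ.erase i₀).image f) : Finset Poly) : Set Poly) := fun i hi =>
        Ideal.subset_span (Finset.mem_coe.mpr (Finset.mem_insert_of_mem (Finset.mem_image_of_mem f
          (Finset.mem_erase.mpr ⟨hi, Finset.mem_univ i⟩))))
      rintro _ ⟨i, rfl⟩
      by_cases hi : i = i₀
      · rw [hi]
        refine hf₀ _ (Ideal.subset_span (Finset.mem_coe.mpr (Finset.mem_insert_self _ _))) ?_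
        rintro _ ⟨k, hk, rfl⟩
        exact h1 k hk
      · exact h1 i hi
  · intro T hT hTI
    obtain ⟨x, hx, hxT⟩ := Finset.exists_of_ssubset hT
    have hall : ∀ i, f i ∈ Submodule.span Poly (T : Set Poly) := fun i => by
      have h1 : f i ∈ I := hspan ▸ Submodule.subset_span (Set.mem_range_self i)
      rw [← hTI] at h1
      exact h1
    rcases Finset.mem_insert.mp hx with rfl | hx
    · refine hirr i₀ (Submodule.span_mono (fun y hy => ?_) (hall i₀))
      rcases Finset.mem_insert.mp (hT.1 hy) with rfl | hy'
      · exact absurd hy hxT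
      · obtain ⟨k, hk, rfl⟩ := Finset.mem_image.mp hy'
        exact ⟨k, by simpa using Finset.ne_of_mem_erase hk, rfl⟩
    · obtain ⟨i₁, hi₁, rfl⟩ := Finset.mem_image.mp hx
      have hne : i₁ ≠ i₀ := Finset.ne_of_mem_erase hi₁
      have h1 : f i₁ ∈ Submodule.span Poly (insert F (f '' {i | i ≠ i₀ ∧ i ≠ i₁})) := by
        refine Submodule.span_mono (fun y hy => ?_) (hall i₁)
        rcases Finset.mem_insert.mp (hT.1 hy) with rfl | hy'
        · exact Set.mem_insert _ _
        · obtain ⟨k, hk, rfl⟩ := Finset.mem_image.mp hy'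
          refine Set.mem_insert_of_mem _ ⟨k, ⟨Finset.ne_of_mem_erase hk, ?_⟩, rfl⟩
          rintro rfl
          exact hxT hy
      obtain ⟨a, z, hz, h2⟩ := Submodule.mem_span_insert.mp h1
      rw [Finsupp.mem_span_image_iff_linearCombination] at hz
      obtain ⟨l, hl, rfl⟩ := hz
      rw [Finsupp.mem_supported'] at hl
      rw [Finsupp.linearCombination_apply, Finsupp.sum_fintype _ _ (by simp)] at h2
      have h3 := hrel (g := fun i => a * c i + l i - if i = i₁ then 1 else 0) (by
        simp only [sub_mul, add_mul, Finset.sum_sub_distrib, Finset.sum_add_distrib, ite_mul,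
          one_mul, zero_mul, Finset.sum_ite_eq', Finset.mem_univ, if_true, mul_assoc,
          ← Finset.mul_sum, hcF]
        rw [h2]
        simp)
      have h4 := h3 i₀
      have h5 := h3 i₁
      simp only [hl i₀ (by simp), hl i₁ (by simp), if_neg hne.symm, if_true, add_zero, sub_zero]
        at h4 h5
      rw [mem_irrelevantIdeal_iff] at h4 h5
      rw [← constantCoeff_eq] at h4 h5 h0
      simp only [map_mul, map_sub, map_one, mul_eq_zero] at h4 h5
      rw [h4.resolve_right h0] at h5
      simp at h5

end ACMCurve

/-! ### Resolutions of curves on a surface -/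

namespace ACMCurve

section Reindex

variable {R ι ι' κ κ' : Type*} [CommRing R] [Fintype κ] [Fintype κ']
  (M : Matrix ι κ R) (f : ι → R) (ρ : ι' ≃ ι) (σ : κ' ≃ κ)

theorem mulVecLin_submatrix_apply (v : κ' → R) :
    (M.submatrix ρ σ).mulVecLin v = M.mulVecLin (v ∘ σ.symm) ∘ ρ := by
  rw [Matrix.mulVecLin_apply, Matrix.mulVecLin_apply, Matrix.submatrix_mulVec_equiv]

theorem linearCombination_comp_equiv_apply [Fintype ι] [Fintype ι'] (v : ι' → R) :
    Fintype.linearCombination R (f ∘ ρ) v = Fintype.linearCombination R f (v ∘ ρ.symm) := by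
  rw [Fintype.linearCombination_apply, Fintype.linearCombination_apply, ← Equiv.sum_comp ρ]
  simp

variable {M f}

theorem injective_mulVecLin_submatrix (h : Function.Injective M.mulVecLin) :
    Function.Injective (M.submatrix ρ σ).mulVecLin := by
  intro v w hvw
  rw [mulVecLin_submatrix_apply, mulVecLin_submatrix_apply] at hvw
  exact σ.symm.surjective.injective_comp_right (h (ρ.surjective.injective_comp_right hvw))

theorem exact_mulVecLin_submatrix [Fintype ι] [Fintype ι']
    (h : Function.Exact M.mulVecLin (Fintype.linearCombination R f)) :
    Function.Exact (M.submatrix ρ σ).mulVecLin (Fintype.linearCombination R (f ∘ ρ)) := by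
  intro v
  rw [linearCombination_comp_equiv_apply, h]
  constructor
  · rintro ⟨w, hw⟩
    refine ⟨w ∘ σ, ?_⟩
    rw [mulVecLin_submatrix_apply, Function.comp_assoc, σ.self_comp_symm, Function.comp_id, hw,
      Function.comp_assoc, ρ.symm_comp_self, Function.comp_id]
  · rintro ⟨w, rfl⟩
    refine ⟨w ∘ σ.symm, ?_⟩
    rw [mulVecLin_submatrix_apply, Function.comp_assoc, ρ.self_comp_symm, Function.comp_id]

end Reindex

/-- The hypothesis on common factors in the Hilbert–Burch theorem, for generators of the ideal of a
curve. -/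
theorem Curve.exists_not_dvd (C : Curve) {ι : Type*} {f : ι → Poly}
    (hspan : Submodule.span Poly (Set.range f) = C.ideal) {p : Poly} (hp : Prime p) :
    ∃ i, ¬ p ∣ f i := by
  obtain ⟨g, hg, hpg⟩ := exists_not_dvd_of_ringKrullDim_quotient_eq_two C.dim_eq hp.not_isUnit
  by_contra! h
  refine hpg ?_
  rw [← Ideal.mem_span_singleton]
  rw [← hspan] at hg
  refine (Submodule.span_le.mpr ?_ : Submodule.span Poly (Set.range f) ≤ Ideal.span {p}) hg
  rintro _ ⟨i, rfl⟩
  exact Ideal.mem_span_singleton.mpr (h i)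

theorem exists_ne_zero_of_mem_span {ι : Type*} {f : ι → Poly} {I : Ideal Poly}
    (hspan : Submodule.span Poly (Set.range f) = I) {F : Poly} (hF0 : F ≠ 0) (hF : F ∈ I) :
    ∃ i, f i ≠ 0 := by
  by_contra! h
  have hle : Submodule.span Poly (Set.range f) ≤ ⊥ := Submodule.span_le.mpr (by
    rintro _ ⟨i, rfl⟩
    exact h i)
  exact hF0 (hle (hspan ▸ hF))

theorem exists_equiv_subtype_ne {ι κ : Type*} (σ : ι ≃ κ ⊕ Unit) {j₀ : ι}
    (hj₀ : σ j₀ = Sum.inr ()) :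
    ∃ τ : {j // j ≠ j₀} ≃ κ, ∀ j, σ j.1 = Sum.inl (τ j) := by
  have h : ∀ j : {j // j ≠ j₀}, ∃ k, σ j.1 = Sum.inl k := by
    rintro ⟨j, hj⟩
    rcases hk : σ j with k | k
    · exact ⟨k, rfl⟩
    · exact absurd (σ.injective (hk.trans hj₀.symm)) hj
  choose τ hτ using h
  refine ⟨Equiv.ofBijective τ ⟨fun j k hjk => ?_, fun k => ?_⟩, hτ⟩
  · exact Subtype.ext (σ.injective (by rw [hτ, hτ, hjk]))
  · have hne : σ.symm (Sum.inl k) ≠ j₀ := by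
      rintro rfl
      simp at hj₀
    refine ⟨⟨_, hne⟩, Sum.inl_injective (β := Unit) ?_⟩
    rw [← hτ, Equiv.apply_symm_apply]

theorem HasMinimalFreeResolution.of_degrees_eq {ι κ : Type} [Fintype ι] [Fintype κ]
    {I : Ideal Poly} {α α' : ι → ℤ} {β β' : κ → ℤ} (h : HasMinimalFreeResolution I α β)
    (hα : ∀ i, α i = α' i) (hβ : ∀ j, β j = β' j) : HasMinimalFreeResolution I α' β' := by
  rwa [← funext hα, ← funext hβ]

theorem HasResolutionWithSurface.of_shift {I : Ideal Poly} {d : ℕ} {p : WeakAdmissiblePair}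
    {k : ℤ} (h : HasResolutionWithSurface I d (p.shift k) 0) : HasResolutionWithSurface I d p k :=
  HasMinimalFreeResolution.of_degrees_eq (ι := Fin p.length ⊕ Unit) (κ := Fin p.length) h
    (by rintro (i | i); exacts [add_zero _, rfl]) fun _ => add_zero _

/-- The degrees in the resolution of a curve on a surface whose equation is not a minimal generator
are invariant under shifts of the pair. -/
theorem HasResolutionWithoutSurface.of_shift {I : Ideal Poly} {d : ℕ} {p : WeakAdmissiblePair}
    {k : ℤ} {j₀ : Fin p.length} (h : HasResolutionWithoutSurface I d (p.shift k) j₀) :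
    HasResolutionWithoutSurface I d p j₀ :=
  HasMinimalFreeResolution.of_degrees_eq (ι := Fin p.length) (κ := {j : Fin p.length // j ≠ j₀}) h
    (fun i => show -(-(d : ℤ) + (p.b j₀ + k) - (p.a i + k)) = _ by ring)
    fun j => show -(-(d : ℤ) + (p.b j₀ + k) - (p.b j + k)) = _ by ring

/-- If the equation `F` of the surface is a minimal generator, deleting its row from the
Hilbert–Burch matrix gives a square matrix with determinant `F`. -/
theorem Curve.IsACM.exists_resolutionWithSurface {C : Curve} (hC : C.IsACM)
    (hCI : ¬ C.IsCompleteIntersection) {d : ℕ} {F : Poly} (hF : F.IsHomogeneous d) (hF0 : F ≠ 0)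
    (hFC : F ∈ C.ideal) (hmin : IsMinimalGenerator F C.ideal) :
    ∃ p, IsWeakDeterminantalOfType F d p ∧ HasResolutionWithSurface C.ideal d p 0 := by
  classical
  obtain ⟨S, hFS, hhom, hspan, hirr⟩ := hmin.exists_irredundant
  have hcard : 2 < S.card := by
    by_contra! h
    exact hCI (isCompleteIntersection_of_card_le_two hhom hspan h)
  obtain ⟨n, hn⟩ : ∃ n, (S.erase F).card = n := ⟨_, rfl⟩
  have hn2 : 2 ≤ n := by rw [← hn, Finset.card_erase_of_mem hFS]; omega
  obtain ⟨e, he⟩ := exists_monotone_equiv (ι := (S.erase F : Finset Poly)) (by simpa using hn)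
    fun g => (g.1.totalDegree : ℤ)
  let a : Fin n → ℤ := fun i => ((e i).1.totalDegree : ℤ)
  let f : Fin n ⊕ Unit → Poly := Sum.elim (fun i => (e i).1) fun _ => F
  have hfS : ∀ i, f i ∈ S := by
    rintro (i | i)
    · exact Finset.mem_of_mem_erase (e i).2
    · exact hFS
  have hfinj : Function.Injective f := by
    refine (Subtype.val_injective.comp e.injective).sumElim (fun _ _ _ => rfl) fun i _ => ?_
    exact Finset.ne_of_mem_erase (e i).2
  have hfrange : Set.range f = S := by
    ext x
    refine ⟨fun ⟨i, hi⟩ => hi ▸ hfS i, fun hx => ?_⟩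
    by_cases hxF : x = F
    · exact ⟨Sum.inr (), hxF.symm⟩
    · exact ⟨Sum.inl (e.symm ⟨x, Finset.mem_erase.mpr ⟨hxF, hx⟩⟩), by simp [f]⟩
  have hff : ∀ i, IsForm (f i) (Sum.elim a (fun _ => (d : ℤ)) i) := by
    rintro (i | i)
    · obtain ⟨k, hk⟩ := hhom (f (Sum.inl i)) (hfS _)
      exact isForm_totalDegree hk
    · exact isForm_natCast_iff.mpr hF
  rw [← hfrange] at hspan
  obtain ⟨m, β, M, hM, hMm, hinj, hex, hrange⟩ := hC.exists_resolution hff hspan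
    (not_mem_span_image_compl hirr hfinj hfS)
  have hf0 := exists_ne_zero_of_mem_span hspan hF0 hFC
  have hmn := card_add_one_eq_of_exact hf0 hinj hex
  simp only [Fintype.card_fin, Fintype.card_sum, Fintype.card_unit, Nat.add_right_cancel_iff]
    at hmn
  subst hmn
  obtain ⟨σ, hσ⟩ := exists_monotone_equiv (Fintype.card_fin m) β
  have hinj' := injective_mulVecLin_submatrix (Equiv.refl _) σ hinj
  have hex' := exact_mulVecLin_submatrix (Equiv.refl _) σ hex
  obtain ⟨u, hu, hdet⟩ := exists_isUnit_det_adjoinColumn hf0 (fun p hp => C.exists_not_dvd hspan hp)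
    hinj' hex'
  set N := M.submatrix (Equiv.refl (Fin m ⊕ Unit)) σ with hN
  have hdetF : (N.submatrix Sum.inl id).det = u * F := by
    have h1 := hdet (Pi.single (Sum.inr ()) 1)
    have h2 : adjoinColumn N (Pi.single (Sum.inr ()) 1) =
        Matrix.fromBlocks (N.submatrix Sum.inl id) 0 (N.submatrix Sum.inr id) 1 := by
      ext i j
      rcases i with i | i <;> rcases j with j | j <;> simp
    rw [h2, Matrix.det_fromBlocks_zero₁₂, Matrix.det_one, mul_one] at h1
    rw [h1]
    simp [f]
  obtain ⟨hab, htype⟩ := isWeakDeterminantalOfType_of_det hn2 he hσ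
    (S := N.submatrix Sum.inl id) (fun i j => hM (Sum.inl i) (σ j)) (fun i j => hMm _ _) hF hF0 hu
    hdetF
  have hres : HasMinimalFreeResolution C.ideal (Sum.elim a fun _ => (d : ℤ)) (β ∘ σ) :=
    ⟨f, N, hff, fun i j => hM i (σ j), fun i j => hMm _ _, hinj', hex', hrange⟩
  refine ⟨_, htype, hres.of_degrees_eq ?_ fun _ => (add_zero _).symm⟩
  rintro (i | i)
  exacts [(add_zero _).symm, rfl]

/-- If the equation `F` of the surface is not a minimal generator, it is a combination of the
minimal generators, and adjoining the column of the coefficients to the Hilbert–Burch matrix gives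
a square matrix with determinant `F`. -/
theorem Curve.IsACM.exists_resolutionWithoutSurface {C : Curve} (hC : C.IsACM)
    (hCI : ¬ C.IsCompleteIntersection) {d : ℕ} {F : Poly} (hF : F.IsHomogeneous d) (hF0 : F ≠ 0)
    (hFC : F ∈ C.ideal) (hmin : ¬ IsMinimalGenerator F C.ideal) :
    ∃ p, IsWeakDeterminantalOfType F d p ∧ ∃ j₀, HasResolutionWithoutSurface C.ideal d p j₀ := by
  classical
  obtain ⟨S, hhom, hspan, hirr⟩ := C.exists_irredundant
  have hcard : 2 < S.card := by
    by_contra! h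
    exact hCI (isCompleteIntersection_of_card_le_two hhom hspan h)
  obtain ⟨n, hn⟩ : ∃ n, S.card = n := ⟨_, rfl⟩
  have hn2 : 2 ≤ n := by omega
  obtain ⟨e, he⟩ := exists_monotone_equiv (ι := S) (by simpa using hn)
    fun g => (g.1.totalDegree : ℤ)
  let a : Fin n → ℤ := fun i => ((e i).1.totalDegree : ℤ)
  let f : Fin n → Poly := fun i => (e i).1
  have hfS : ∀ i, f i ∈ S := fun i => (e i).2
  have hfinj : Function.Injective f := Subtype.val_injective.comp e.injective
  have hfrange : Set.range f = S := by
    ext x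
    exact ⟨fun ⟨i, hi⟩ => hi ▸ hfS i, fun hx => ⟨e.symm ⟨x, hx⟩, by simp [f]⟩⟩
  have hff : ∀ i, IsForm (f i) (a i) := fun i =>
    isForm_totalDegree (hhom (f i) (hfS i)).choose_spec
  rw [← hfrange] at hspan
  have hirr' := not_mem_span_image_compl hirr hfinj hfS
  obtain ⟨m, β, M, hM, hMm, hinj, hex, hrange⟩ := hC.exists_resolution hff hspan hirr'
  have hf0 := exists_ne_zero_of_mem_span hspan hF0 hFC
  have hmn := card_add_one_eq_of_exact hf0 hinj hex
  simp only [Fintype.card_fin] at hmn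
  -- the coefficients of `F`, made homogeneous
  obtain ⟨c₀, hc₀⟩ : ∃ c : Fin n → Poly, ∑ i, c i * f i = F := by
    rw [← hrange] at hFC
    obtain ⟨c, hc⟩ := hFC
    exact ⟨c, by simpa [Fintype.linearCombination_apply] using hc⟩
  let c : Fin n → Poly := fun i => formComponent (d - a i) (c₀ i)
  have hcform : ∀ i, IsForm (c i) (d - a i) := fun i => isForm_formComponent _ _
  have hcF : ∑ i, c i * f i = F := by
    have h1 := formComponent_of_isForm (isForm_natCast_iff.mpr hF)
    rw [← hc₀, map_sum] at h1
    rw [← hc₀, ← h1]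
    exact Finset.sum_congr rfl fun i _ => (formComponent_mul_of_isForm (hff i) _ _).symm
  have hcm : ∀ i, c i ∈ irrelevantIdeal := mem_irrelevantIdeal_of_not_isMinimalGenerator hff
    (fun i => hhom (f i) (hfS i)) hspan hirr' hF hmin hcform hcF
  -- the degrees of the columns of the Hilbert–Burch matrix and of the new column, in order
  obtain ⟨σ, hσ⟩ := exists_monotone_equiv (ι := Fin m ⊕ Unit) (n := n) (by simpa using hmn)
    (Sum.elim β fun _ => (d : ℤ))
  have hinj' := injective_mulVecLin_submatrix σ.symm (Equiv.refl _) hinj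
  have hex' := exact_mulVecLin_submatrix σ.symm (Equiv.refl _) hex
  obtain ⟨u, hu, hdet⟩ := exists_isUnit_det_adjoinColumn
    (by obtain ⟨i, hi⟩ := hf0; exact ⟨σ i, by simpa using hi⟩)
    (fun p hp => C.exists_not_dvd (by rw [EquivLike.range_comp]; exact hspan) hp) hinj' hex'
  let N := (adjoinColumn (M.submatrix σ.symm (Equiv.refl (Fin m))) (c ∘ σ.symm)).submatrix σ σ
  have hdetF : N.det = u * F := by
    rw [Matrix.det_submatrix_equiv_self, hdet, ← hcF, ← Equiv.sum_comp σ.symm]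
    rfl
  have hNl : ∀ i j k, σ j = Sum.inl k → N i j = M i k := fun i j k hk => by simp [N, hk]
  have hNr : ∀ i j k, σ j = Sum.inr k → N i j = c i := fun i j k hk => by simp [N, hk]
  obtain ⟨hab, htype⟩ := isWeakDeterminantalOfType_of_det hn2 he hσ (S := N)
    (fun i j => by
      rcases hj : σ j with k | k
      · rw [hNl i j k hj]; simpa [hj] using hM i k
      · rw [hNr i j k hj]; simpa [hj] using hcform i)
    (fun i j => by
      rcases hj : σ j with k | k
      · rw [hNl i j k hj]; exact hMm i k
      · rw [hNr i j k hj]; exact hcm i) hF hF0 hu hdetF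
  obtain ⟨j₀, hj₀⟩ := σ.surjective (Sum.inr ())
  obtain ⟨τ, hτ⟩ := exists_equiv_subtype_ne σ hj₀
  have hexτ := exact_mulVecLin_submatrix (Equiv.refl _) τ hex
  rw [Equiv.coe_refl, Function.comp_id] at hexτ
  have hres : HasMinimalFreeResolution C.ideal a (β ∘ τ) :=
    ⟨f, M.submatrix id τ, hff, fun i j => hM i (τ j), fun i j => hMm i (τ j),
      injective_mulVecLin_submatrix (Equiv.refl _) τ hinj,
      hexτ, hrange⟩
  refine ⟨_, htype, j₀, hres.of_degrees_eq (fun i => ?_) fun j => ?_⟩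
  · change a i = -(-(d : ℤ) + Sum.elim β (fun _ => (d : ℤ)) (σ j₀) - a i)
    rw [hj₀, Sum.elim_inr]
    ring
  · change β (τ j) = -(-(d : ℤ) + Sum.elim β (fun _ => (d : ℤ)) (σ j₀) -
      Sum.elim β (fun _ => (d : ℤ)) (σ j))
    rw [hj₀, hτ, Sum.elim_inr, Sum.elim_inl]
    ring

end ACMCurve

open ACMCurve
theorem theorem1 (d : ℕ) (hd : 1 ≤ d) (F : Poly) (hF : F.IsHomogeneous d) (hF0 : F ≠ 0)
    (C : Curve) (hFC : F ∈ C.ideal)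
    {ι : Type*} (T : ι → WeakAdmissiblePair) (hT : IsFamilyOfTypes F d T) :
    C.IsACM ↔
      (¬ IsWeakDeterminantal F d ∧ C.IsCompleteIntersection) ∨
      (IsWeakDeterminantal F d ∧
        (C.IsCompleteIntersection ∨
          (¬ C.IsCompleteIntersection ∧ IsMinimalGenerator F C.ideal ∧
            ∃ (i : ι) (k : ℤ), HasResolutionWithSurface C.ideal d (T i) k) ∨
          (¬ C.IsCompleteIntersection ∧ ¬ IsMinimalGenerator F C.ideal ∧
            ∃ (i : ι) (j₀ : Fin (T i).length),
              HasResolutionWithoutSurface C.ideal d (T i) j₀))) := by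
  constructor
  · intro hC
    by_cases hCI : C.IsCompleteIntersection
    · by_cases hX : IsWeakDeterminantal F d
      · exact Or.inr ⟨hX, Or.inl hCI⟩
      · exact Or.inl ⟨hX, hCI⟩
    · by_cases hmin : IsMinimalGenerator F C.ideal
      · obtain ⟨p, hp, hres⟩ := hC.exists_resolutionWithSurface hCI hF hF0 hFC hmin
        refine Or.inr ⟨⟨p, hp⟩, Or.inr (Or.inl ⟨hCI, hmin, ?_⟩)⟩
        obtain ⟨i, k, rfl⟩ := hT.2 p hp
        exact ⟨i, k, hres.of_shift⟩
      · obtain ⟨p, hp, j₀, hres⟩ := hC.exists_resolutionWithoutSurface hCI hF hF0 hFC hmin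
        refine Or.inr ⟨⟨p, hp⟩, Or.inr (Or.inr ⟨hCI, hmin, ?_⟩)⟩
        obtain ⟨i, k, rfl⟩ := hT.2 p hp
        exact ⟨i, j₀, hres.of_shift⟩
  · rintro (⟨-, h⟩ | ⟨-, h | ⟨-, -, i, k, h⟩ | ⟨-, -, i, j₀, h⟩⟩)
    · exact h.isACM
    · exact h.isACM
    · exact Curve.isACM_of_hasMinimalFreeResolution h
    · exact Curve.isACM_of_hasMinimalFreeResolution h
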